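/- Let $(M,S)$ be a tangent manifold: $M$ is a smooth (Hausdorff) manifold and $S$ is a smooth field of endomorphisms of $TM$ with $S^2=0$ and $\operatorname{im}S=\ker S$, which is integrable, i.e. near every point there are coordinates $(x^i,y^i)$ with $S(\partial/\partial x^i)=\partial/\partial y^i$, $S(\partial/\partial y^i)=0$. Let $N\subset TM$ be a normalization (horizontal bundle), i.e. a smooth distribution with $TM=N\oplus\operatorname{im}S$, with projections $p_N,p_T$. Let $g$ be a (non degenerate, possibly indefinite) metric of the transversal bundle $TM/\operatorname{im}S$, seen as a symmetric $2$-covariant tensor on $M$ annihilated by $\operatorname{im}S$. Let $\gamma$ be the canonical extension of $g$, i.e. the pseudo-Riemannian metric for which $N\perp\operatorname{im}S$, $\gamma(SX,SY)=\gamma(X,Y)$ for $X,Y\in\Gamma N$, and $\gamma|_N=g|_N$. Let $\nabla$ be the Levi-Civita connection of $\gamma$, and let $D$ be the (second) canonical connection, given by $$D_{Z_1}Z_2=p_N\nabla_{Z_1}Z_2,\quad D_{Y_1}Y_2=p_T\nabla_{Y_1}Y_2,\quad D_{Y_1}Z_2=p_N[Y_1,Z_2],\quad D_{Z_1}Y_2=p_T[Z_1,Y_2]$$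 for $Z_1,Z_2\in\Gamma N$ and $Y_1,Y_2\in\Gamma(\operatorname{im}S)$. A local vector field is called foliated if its bracket with every local section of $\operatorname{im}S$ is a section of $\operatorname{im}S$. The derivative (Cartan) tensor of $g$ is $C_x(X,Y,Z)=(L_{S\tilde X}g)_x(Y,Z)$, where $\tilde X$ is a foliated extension of $X\in T_xM$ to a neighbourhood of $x$. The metric $g$ is called locally Lagrange if near every point there is a smooth function $\mathcal L$ with $g=\operatorname{Hess}\mathcal L$, where $(\operatorname{Hess}\mathcal L)_x(X_1,X_2)=(S\tilde X_2)(S\tilde X_1)\mathcal L|_x$ with $\tilde X_i$ foliated extensions of $X_i$. A pseudo-Riemannian metric is called locally Lagrange-Riemann if it is the canonical extension of a locally Lagrange metric for some normalization. Then $C_x(X,Y,Z)$ does not depend on the choice of $\tilde X$ and, for all $X,Y,Z\in\Gamma N$, $$C(X,Y,Z)=(D_{SX}g)(Y,Z)=(D_{SX}\gamma)(Y,Z)=\gamma(\nabla_Y(SX),Z)+\gamma(Y,\nabla_Z(SX));$$ in particular this holds if $(M,S,g)$ is a locally Lagrange manifold. Moreover, $\gamma$ is a locally Lagrange-Riemann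 metric if and only if $$(D_{SX}\gamma)(Y,Z)=(D_{SY}\gamma)(X,Z)\quad\text{for all }X,Y,Z\in\Gamma N,$$ and also if and only if $$\gamma(\nabla_Y(SX),Z)+\gamma(Y,\nabla_Z(SX))=\gamma(\nabla_X(SY),Z)+\gamma(X,\nabla_Z(SY))\quad\text{for all }X,Y,Z\in\Gamma N.$$ -/

import Mathlib

open Bundle Set VectorField
open scoped Manifold ContDiff Topology

noncomputable section

namespace LagrangeGeometry

section Basic

variable {E : Type*} [NormedAddCommGroup E] [NormedSpace ℝ E]
  {M : Type*} [TopologicalSpace M] [ChartedSpace E M]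

variable (E M) in
/-- A (not necessarily smooth) vector field on `M`. -/
abbrev VField : Type _ := Π x : M, TangentSpace 𝓘(ℝ, E) x

variable (E M) in
/-- A (not necessarily smooth) field of bilinear forms on the tangent spaces of `M`. -/
abbrev BForm : Type _ :=
  Π x : M, TangentSpace 𝓘(ℝ, E) x →L[ℝ] TangentSpace 𝓘(ℝ, E) x →L[ℝ] ℝ

variable (E M) in
/-- A (not necessarily smooth) field of endomorphisms of the tangent spaces of `M`. -/
abbrev EndField : Type _ :=
  Π x : M, TangentSpace 𝓘(ℝ, E) x →L[ℝ] TangentSpace 𝓘(ℝ, E) x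

/-- The derivative `V f` of a function along a vector field, as a function on `M`. -/
def dirDeriv (V : VField E M) (f : M → ℝ) (p : M) : ℝ :=
  mvfderiv 𝓘(ℝ, E) f p (V p)

variable [IsManifold 𝓘(ℝ, E) ∞ M]

/-- The vector field `X` is smooth on the set `W`. -/
def SmoothOn (X : VField E M) (W : Set M) : Prop :=
  ContMDiffOn 𝓘(ℝ, E) 𝓘(ℝ, E).tangent ∞
    (fun x ↦ (TotalSpace.mk' E x (X x) : TangentBundle 𝓘(ℝ, E) M)) W

/-- The field of bilinear forms `b` is smooth on `M`. -/
def SmoothForm (b : BForm E M) : Prop :=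
  ContMDiff 𝓘(ℝ, E) (𝓘(ℝ, E).prod 𝓘(ℝ, E →L[ℝ] E →L[ℝ] ℝ)) ∞
    (fun x ↦ TotalSpace.mk' (E →L[ℝ] E →L[ℝ] ℝ)
      (E := fun x : M ↦
        (TangentSpace 𝓘(ℝ, E) x →L[ℝ] TangentSpace 𝓘(ℝ, E) x →L[ℝ] ℝ)) x (b x))

/-- The field of endomorphisms `A` is smooth on `M`. -/
def SmoothEnd (A : EndField E M) : Prop :=
  ContMDiff 𝓘(ℝ, E) (𝓘(ℝ, E).prod 𝓘(ℝ, E →L[ℝ] E)) ∞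
    (fun x ↦ TotalSpace.mk' (E →L[ℝ] E)
      (E := fun x : M ↦ (TangentSpace 𝓘(ℝ, E) x →L[ℝ] TangentSpace 𝓘(ℝ, E) x)) x (A x))

/-- The Lie derivative `L_V b` of a covariant `2`-tensor field `b`, evaluated on vector fields:
`(L_V b)(Y, Z) = V (b(Y, Z)) - b([V, Y], Z) - b(Y, [V, Z])`. -/
def lieDerivForm (V : VField E M) (b : BForm E M) (Y Z : VField E M) (p : M) : ℝ :=
  dirDeriv V (fun x ↦ b x (Y x) (Z x)) p
    - b p (mlieBracket 𝓘(ℝ, E) V Y p) (Z p)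
    - b p (Y p) (mlieBracket 𝓘(ℝ, E) V Z p)

variable (E M) in
/-- A tangent structure on `M`: a smooth field `S` of endomorphisms with `S² = 0` and
`im S = ker S`, which is integrable: near every point there are local coordinates
`(xⁱ, yⁱ)`, `i < n`, with `S (∂/∂xⁱ) = ∂/∂yⁱ` and `S (∂/∂yⁱ) = 0`.
The coordinates `(x, y)` are `L ∘ φ`, with `φ` a chart of the smooth structure and `L` a linear
identification of the model space with `ℝⁿ × ℝⁿ`. -/
structure TangentStructure where
  /-- The endomorphism field. -/
  S : EndField E M
  smooth : SmoothEnd S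
  sq_zero : ∀ x, ∀ v, S x (S x v) = 0
  range_eq_ker : ∀ x, (S x).range = (S x).ker
  integrable : ∀ p : M, ∃ φ ∈ IsManifold.maximalAtlas 𝓘(ℝ, E) ∞ M, p ∈ φ.source ∧
    ∃ (n : ℕ) (L : E ≃L[ℝ] (Fin n → ℝ) × (Fin n → ℝ)), ∀ y ∈ φ.source,
      ∀ v : TangentSpace 𝓘(ℝ, E) y,
        L (mfderiv 𝓘(ℝ, E) 𝓘(ℝ, E) φ y (S y v))
          = (0, (L (mfderiv 𝓘(ℝ, E) 𝓘(ℝ, E) φ y v)).1)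

/-- The vector field `S X`. -/
def TangentStructure.app (T : TangentStructure E M) (X : VField E M) : VField E M :=
  fun x ↦ T.S x (X x)

/-- The vector field `X`, smooth on the open set `W`, is foliated (projectable) on `W` for the
vertical foliation `T𝒱 = im S`: its bracket with every local vertical vector field is vertical. -/
structure IsFoliatedOn (T : TangentStructure E M) (X : VField E M) (W : Set M) : Prop where
  isOpen : IsOpen W
  smooth : SmoothOn X W
  bracket : ∀ (V : VField E M) (W' : Set M), IsOpen W' → W' ⊆ W → SmoothOn V W' →
    (∀ x ∈ W', V x ∈ (T.S x).range) →
    ∀ x ∈ W', mlieBracket 𝓘(ℝ, E) X V x ∈ (T.S x).range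

end Basic

section Foliated

variable {E : Type*} [NormedAddCommGroup E] [NormedSpace ℝ E] [FiniteDimensional ℝ E]
  {M : Type*} [TopologicalSpace M] [ChartedSpace E M] [IsManifold 𝓘(ℝ, E) ∞ M]

/-- Every tangent vector extends to a foliated vector field on a neighbourhood (take constant
components in adapted coordinates). -/
theorem exists_foliated_extension (T : TangentStructure E M) (p : M)
    (u : TangentSpace 𝓘(ℝ, E) p) :
    ∃ X : VField E M, (∃ W : Set M, p ∈ W ∧ IsFoliatedOn T X W) ∧ X p = u := by
  have : CompleteSpace E := FiniteDimensional.complete ℝ E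
  have htwo : (2 : WithTop ℕ∞) ≤ ∞ := ENat.LEInfty.out
  have hms : minSmoothness ℝ 2 = 2 := by simp
  have : IsManifold 𝓘(ℝ, E) (minSmoothness ℝ 2) M := by rw [hms]; infer_instance
  have : IsManifold 𝓘(ℝ, E) (minSmoothness ℝ 2) E := by infer_instance
  obtain ⟨φ, hφ, hp, n, L, hL⟩ := T.integrable p
  have hsm : ContMDiffOn 𝓘(ℝ, E) 𝓘(ℝ, E) ∞ φ φ.source := contMDiffOn_of_mem_maximalAtlas hφ
  have hsm' : ContMDiffOn 𝓘(ℝ, E) 𝓘(ℝ, E) ∞ φ.symm φ.target :=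
    contMDiffOn_symm_of_mem_maximalAtlas hφ
  have hd : φ.MDifferentiable 𝓘(ℝ, E) 𝓘(ℝ, E) :=
    ⟨hsm.mdifferentiableOn (by simp), hsm'.mdifferentiableOn (by simp)⟩
  have hinv : ∀ y ∈ φ.source, (mfderiv 𝓘(ℝ, E) 𝓘(ℝ, E) φ y).IsInvertible :=
    fun y hy ↦ ⟨hd.mfderiv hy, rfl⟩
  have hinv' : ∀ z ∈ φ.target, (mfderiv 𝓘(ℝ, E) 𝓘(ℝ, E) φ.symm z).IsInvertible :=
    fun z hz ↦ ⟨hd.symm.mfderiv hz, rfl⟩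
  have hvert : ∀ y ∈ φ.source, ∀ v : TangentSpace 𝓘(ℝ, E) y, v ∈ (T.S y).range ↔
      (L (mfderiv 𝓘(ℝ, E) 𝓘(ℝ, E) φ y v)).1 = 0 := by
    intro y hy v
    rw [T.range_eq_ker, LinearMap.mem_ker]
    have h := hL y hy v
    constructor
    · intro hv
      have hv' : T.S y v = 0 := hv
      rw [hv', map_zero] at h
      have h0 : L (0 : E) = (0, (L (mfderiv 𝓘(ℝ, E) 𝓘(ℝ, E) φ y v)).1) := h
      rw [map_zero] at h0
      exact (congrArg Prod.snd h0).symm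
    · intro hv
      rw [hv] at h
      have h1 : L (mfderiv 𝓘(ℝ, E) 𝓘(ℝ, E) φ y (T.S y v)) = L 0 := by
        rw [h, map_zero]; rfl
      have h2 := L.injective h1
      exact hd.mfderiv_injective hy (h2.trans (map_zero _).symm)
  let c : E := mfderiv 𝓘(ℝ, E) 𝓘(ℝ, E) φ p u
  let K : VField E E := fun _ ↦ c
  have hK : ContMDiff 𝓘(ℝ, E) 𝓘(ℝ, E).tangent ∞
      (fun x ↦ (TotalSpace.mk' E x (K x) : TangentBundle 𝓘(ℝ, E) E)) := by
    rw [contMDiff_vectorSpace_iff_contDiff]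
    exact contDiff_const
  refine ⟨mpullback 𝓘(ℝ, E) 𝓘(ℝ, E) φ K, ⟨φ.source, hp, φ.open_source, ?_, ?_⟩, ?_⟩
  · intro y hy
    exact (ContMDiffAt.mpullback_vectorField_preimage (n := ∞) (m := ∞) (hK _)
      (hsm.contMDiffAt (φ.open_source.mem_nhds hy)) (hinv y hy) (by simp)).contMDiffWithinAt
  · intro V W' hW' hWs hV hvV x hx
    have hxs := hWs hx
    rw [hvert x hxs]
    let V' : VField E E := mpullback 𝓘(ℝ, E) 𝓘(ℝ, E) φ.symm V
    have hV'eq : ∀ z ∈ φ.target, V' z =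
        mfderiv 𝓘(ℝ, E) 𝓘(ℝ, E) φ (φ.symm z) (V (φ.symm z)) := by
      intro z hz
      have : (mfderiv 𝓘(ℝ, E) 𝓘(ℝ, E) φ.symm z).inverse
          = mfderiv 𝓘(ℝ, E) 𝓘(ℝ, E) φ (φ.symm z) := by
        apply ContinuousLinearMap.inverse_eq
        · have := hd.symm_comp_deriv (φ.map_target hz)
          rwa [φ.right_inv hz] at this
        · exact hd.comp_symm_deriv hz
      simp only [V', mpullback_apply, this]
      rfl
    have hV's : ContMDiffAt 𝓘(ℝ, E) 𝓘(ℝ, E).tangent ∞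
        (fun x ↦ (TotalSpace.mk' E x (V' x) : TangentBundle 𝓘(ℝ, E) E)) (φ x) := by
      refine ContMDiffAt.mpullback_vectorField_preimage (n := ∞) ?_
        (hsm'.contMDiffAt (φ.open_target.mem_nhds (φ.map_source hxs)))
        (hinv' _ (φ.map_source hxs)) (by simp)
      rw [φ.left_inv hxs]
      exact hV.contMDiffAt (hW'.mem_nhds hx)
    have hV' := hV's.mdifferentiableAt (by simp)
    have hVV : V =ᶠ[𝓝 x] mpullback 𝓘(ℝ, E) 𝓘(ℝ, E) φ V' := by
      filter_upwards [φ.open_source.mem_nhds hxs] with y hy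
      rw [mpullback_apply, hV'eq _ (φ.map_source hy), φ.left_inv hy]
      exact ((hinv y hy).inverse_apply_eq.2 rfl).symm
    have hb : mlieBracket 𝓘(ℝ, E) (mpullback 𝓘(ℝ, E) 𝓘(ℝ, E) φ K) V x =
        (mfderiv 𝓘(ℝ, E) 𝓘(ℝ, E) φ x).inverse (mlieBracket 𝓘(ℝ, E) K V' (φ x)) := by
      have h0 : mlieBracket 𝓘(ℝ, E) (mpullback 𝓘(ℝ, E) 𝓘(ℝ, E) φ K) V x =
          mlieBracket 𝓘(ℝ, E) (mpullback 𝓘(ℝ, E) 𝓘(ℝ, E) φ K)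
            (mpullback 𝓘(ℝ, E) 𝓘(ℝ, E) φ V') x :=
        Filter.EventuallyEq.mlieBracket_vectorField_eq (Filter.EventuallyEq.refl _ _) hVV
      rw [h0, ← mpullback_mlieBracket (n := ∞) ((hK _).mdifferentiableAt (by simp)) hV'
          (hsm.contMDiffAt (φ.open_source.mem_nhds hxs)) (by simpa using htwo)]
      rfl
    have hb' : mfderiv 𝓘(ℝ, E) 𝓘(ℝ, E) φ x
        (mlieBracket 𝓘(ℝ, E) (mpullback 𝓘(ℝ, E) 𝓘(ℝ, E) φ K) V x) =
        mlieBracket 𝓘(ℝ, E) K V' (φ x) := by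
      rw [hb]; exact ((hinv x hxs).inverse_apply_eq.1 rfl).symm
    rw [hb', ← mlieBracketWithin_univ, mlieBracketWithin_eq_lieBracketWithin]
    let F : E → E := V'
    have hF : DifferentiableAt ℝ F (φ x) :=
      (contMDiffAt_vectorSpace_iff_contDiffAt.1 hV's).differentiableAt (by simp)
    let l : E →L[ℝ] (Fin n → ℝ) :=
      (ContinuousLinearMap.fst ℝ (Fin n → ℝ) (Fin n → ℝ)).comp (L : E →L[ℝ] _)
    have hz : (fun z ↦ l (F z)) =ᶠ[𝓝 (φ x)] fun _ ↦ 0 := by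
      have h1 : φ.symm ⁻¹' W' ∈ 𝓝 (φ x) := by
        apply (φ.continuousAt_symm (φ.map_source hxs)).preimage_mem_nhds
        rw [φ.left_inv hxs]; exact hW'.mem_nhds hx
      filter_upwards [h1, φ.open_target.mem_nhds (φ.map_source hxs)] with z hz1 hz2
      have := (hvert _ (φ.map_target hz2) _).1 (hvV _ hz1)
      change (L (V' z)).1 = 0
      rw [hV'eq z hz2]; exact this
    have hfd : l.comp (fderiv ℝ F (φ x)) = 0 := by
      have h1 : fderiv ℝ (fun z ↦ l (F z)) (φ x) = l.comp (fderiv ℝ F (φ x)) :=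
        (l.hasFDerivAt.comp _ hF.hasFDerivAt).fderiv
      rw [← h1, hz.fderiv_eq, fderiv_fun_const]; rfl
    have h2 : lieBracket ℝ (fun _ ↦ c) F (φ x) = fderiv ℝ F (φ x) c := by
      simp [lieBracket]
    change l (lieBracketWithin ℝ (fun _ ↦ c) F univ (φ x)) = 0
    rw [lieBracketWithin_univ, h2]
    exact congrArg (fun A : E →L[ℝ] (Fin n → ℝ) ↦ A c) hfd
  · rw [mpullback_apply]
    exact (hinv p hp).inverse_apply_eq.2 rfl

end Foliated

section Lagrange

variable {E : Type*} [NormedAddCommGroup E] [NormedSpace ℝ E] [FiniteDimensional ℝ E]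
  {M : Type*} [TopologicalSpace M] [ChartedSpace E M] [IsManifold 𝓘(ℝ, E) ∞ M]

/-- A vector field which extends the tangent vector `u` at `p` and is foliated near `p`. -/
def foliatedExtension (T : TangentStructure E M) (p : M) (u : TangentSpace 𝓘(ℝ, E) p) :
    VField E M :=
  (exists_foliated_extension T p u).choose

/-- The Hessian of the Lagrangian `f`: `(Hess f)_p(u, v) = (S Ṽ)((S Ũ) f) (p)`, with `Ũ, Ṽ`
foliated extensions of `u, v`. -/
def hessian (T : TangentStructure E M) (f : M → ℝ) (p : M)
    (u v : TangentSpace 𝓘(ℝ, E) p) : ℝ :=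
  dirDeriv (T.app (foliatedExtension T p v)) (dirDeriv (T.app (foliatedExtension T p u)) f) p

/-- A metric of the transversal bundle `TM / im S` of the vertical foliation, possibly indefinite,
seen as a symmetric bilinear tensor field on `M` that is annihilated by `im S`, and which is
non degenerate on `TM / im S`. -/
structure TransversalMetric (T : TangentStructure E M) where
  /-- The tensor field on `M`. -/
  form : BForm E M
  smooth : SmoothForm form
  symm : ∀ x u v, form x u v = form x v u
  vertical : ∀ x u v, form x (T.S x u) v = 0
  nondegenerate : ∀ x u, (∀ v, form x u v = 0) → u ∈ (T.S x).range

/-- `g` is a locally Lagrange metric: it is locally the Hessian of smooth local Lagrangians. (These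
are automatically regular, since `g` is non degenerate.) -/
def TransversalMetric.IsLocallyLagrange {T : TangentStructure E M} (g : TransversalMetric T) :
    Prop :=
  ∀ p : M, ∃ (U : Set M) (f : M → ℝ), IsOpen U ∧ p ∈ U ∧
    ContMDiffOn 𝓘(ℝ, E) 𝓘(ℝ, ℝ) ∞ f U ∧
    ∀ x ∈ U, ∀ u v, g.form x u v = hessian T f x u v

/-- The derivative (Cartan) tensor of `g`: `C_p(u, v, w) = (L_{S Ũ} g)_p(v, w)`, with `Ũ` a
foliated extension of `u`. -/
def cartanTensor {T : TangentStructure E M} (g : TransversalMetric T) (p : M)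
    (u v w : TangentSpace 𝓘(ℝ, E) p) : ℝ :=
  lieDerivForm (T.app (foliatedExtension T p u)) g.form
    (FiberBundle.extend E v) (FiberBundle.extend E w) p

/-- A normalization of the vertical foliation, i.e. a smooth distribution `N` with
`TM = N ⊕ im S`, given by the projection `p_N` onto `N` along `im S`. -/
structure Normalization (T : TangentStructure E M) where
  /-- The projection onto the horizontal distribution. -/
  pN : EndField E M
  smooth : SmoothEnd pN
  idem : ∀ x, ∀ v, pN x (pN x v) = pN x v
  ker_eq : ∀ x, (pN x).ker = (T.S x).range

namespace Normalization

variable {T : TangentStructure E M} (N : Normalization T)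

/-- The horizontal space at `x`. -/
def horizontal (x : M) : Submodule ℝ (TangentSpace 𝓘(ℝ, E) x) := (N.pN x).range

/-- The horizontal part `p_N X` of a vector field. -/
def hor (X : VField E M) : VField E M := fun x ↦ N.pN x (X x)

/-- The vertical part `p_T X` of a vector field. -/
def ver (X : VField E M) : VField E M := fun x ↦ X x - N.pN x (X x)

/-- `X` is a smooth section of the horizontal bundle `N`. -/
def IsHorizontalField (X : VField E M) : Prop :=
  SmoothOn X univ ∧ ∀ x, X x ∈ N.horizontal x

end Normalization

variable (E M) in
/-- A pseudo-Riemannian metric on `M`. -/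
structure PseudoRiemannianMetric where
  /-- The metric tensor. -/
  form : BForm E M
  smooth : SmoothForm form
  symm : ∀ x u v, form x u v = form x v u
  nondegenerate : ∀ x u, (∀ v, form x u v = 0) → u = 0

/-- `γ` is the canonical extension of `g` for the normalization `N`: the horizontal and the
vertical distribution are `γ`-orthogonal, `γ(SX, SY) = γ(X, Y)` for horizontal `X, Y`
(that is, `γ` is compatible), and `γ` restricts to `g` on `N`. -/
structure IsCanonicalExtension {T : TangentStructure E M} (N : Normalization T)
    (g : TransversalMetric T) (γ : PseudoRiemannianMetric E M) : Prop where
  orthogonal : ∀ x, ∀ u ∈ N.horizontal x, ∀ v ∈ (T.S x).range, γ.form x u v = 0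
  compatible : ∀ x, ∀ u ∈ N.horizontal x, ∀ v ∈ N.horizontal x,
    γ.form x (T.S x u) (T.S x v) = γ.form x u v
  restrict : ∀ x, ∀ u ∈ N.horizontal x, ∀ v ∈ N.horizontal x, γ.form x u v = g.form x u v

/-- `γ` is a locally Lagrange-Riemann metric of `(M, S)`: it is the canonical extension of a
locally Lagrange metric, for some normalization (necessarily the `γ`-orthogonal bundle of
`im S`). -/
def IsLocallyLagrangeRiemann (T : TangentStructure E M) (γ : PseudoRiemannianMetric E M) : Prop :=
  ∃ (N : Normalization T) (g : TransversalMetric T),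
    g.IsLocallyLagrange ∧ IsCanonicalExtension N g γ

/-- `nabla` is the Levi-Civita connection of `γ`: it is torsion free and metric.
Here `nabla Y p u` is the covariant derivative of `Y` in the direction `u ∈ T_pM`. -/
structure IsLeviCivita (γ : PseudoRiemannianMetric E M)
    (nabla : CovariantDerivative 𝓘(ℝ, E) E (fun x : M ↦ TangentSpace 𝓘(ℝ, E) x)) : Prop where
  torsion_free : ∀ (p : M) (X Y : VField E M),
    MDifferentiableAt 𝓘(ℝ, E) 𝓘(ℝ, E).tangent
      (fun x ↦ (TotalSpace.mk' E x (X x) : TangentBundle 𝓘(ℝ, E) M)) p →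
    MDifferentiableAt 𝓘(ℝ, E) 𝓘(ℝ, E).tangent
      (fun x ↦ (TotalSpace.mk' E x (Y x) : TangentBundle 𝓘(ℝ, E) M)) p →
    nabla Y p (X p) - nabla X p (Y p) = mlieBracket 𝓘(ℝ, E) X Y p
  metric : ∀ (p : M) (Y Z : VField E M),
    MDifferentiableAt 𝓘(ℝ, E) 𝓘(ℝ, E).tangent
      (fun x ↦ (TotalSpace.mk' E x (Y x) : TangentBundle 𝓘(ℝ, E) M)) p →
    MDifferentiableAt 𝓘(ℝ, E) 𝓘(ℝ, E).tangent
      (fun x ↦ (TotalSpace.mk' E x (Z x) : TangentBundle 𝓘(ℝ, E) M)) p →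
    ∀ u : TangentSpace 𝓘(ℝ, E) p,
      mvfderiv 𝓘(ℝ, E) (fun x ↦ γ.form x (Y x) (Z x)) p u
        = γ.form p (nabla Y p u) (Z p) + γ.form p (Y p) (nabla Z p u)

/-- The (second) canonical connection `D`, as an operator `(X, Y) ↦ D_X Y` on vector fields. It is
determined by the Levi-Civita connection `∇` and the normalization through
`D_{Z₁} Z₂ = p_N ∇_{Z₁} Z₂`, `D_{Y₁} Y₂ = p_T ∇_{Y₁} Y₂`, `D_{Y₁} Z₂ = p_N [Y₁, Z₂]` and
`D_{Z₁} Y₂ = p_T [Z₁, Y₂]`, for `Z₁, Z₂` horizontal and `Y₁, Y₂` vertical. -/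
def canonicalConnection {T : TangentStructure E M} (N : Normalization T)
    (nabla : CovariantDerivative 𝓘(ℝ, E) E (fun x : M ↦ TangentSpace 𝓘(ℝ, E) x))
    (X Y : VField E M) : VField E M :=
  N.hor (fun x ↦ nabla (N.hor Y) x (N.hor X x))
    + N.ver (fun x ↦ nabla (N.ver Y) x (N.ver X x))
    + N.hor (mlieBracket 𝓘(ℝ, E) (N.ver X) (N.hor Y))
    + N.ver (mlieBracket 𝓘(ℝ, E) (N.hor X) (N.ver Y))

/-- The covariant derivative of a bilinear tensor field `b` for an operator `D` of covariant
differentiation: `(D_X b)(Y, Z) = X (b(Y, Z)) - b(D_X Y, Z) - b(Y, D_X Z)`. -/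
def covDerivForm (D : VField E M → VField E M → VField E M) (b : BForm E M)
    (X Y Z : VField E M) (p : M) : ℝ :=
  dirDeriv X (fun x ↦ b x (Y x) (Z x)) p - b p (D X Y p) (Z p) - b p (Y p) (D X Z p)

end Lagrange

end LagrangeGeometry
end

/-! Everything reduces to a computation in adapted coordinates `(x, y)`, where `S` becomes the
constant endomorphism `J (x, y) = (0, x)`, called `verticalShift`. Since `g` kills vertical vectors,
it is given by a matrix `G(x, y)` on the `x`-components. If `V` is vertical near `p`, its components
differentiate to vertical vectors, so the bracket `[V, Y] = DY·V - DV·Y` contributes only `DY·V` to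
`L_V g`. This cancels the product-rule terms and leaves the derivative of `G` along `V`
(`lieDerivForm_eq`). With `V = SX`, the Cartan tensor at `p` is the `y`-derivative `DG(JX)(Y, Z)`;
it involves only values at `p`, which proves independence of the extension
(`cartanTensor_eq_lieDerivForm`).

For horizontal fields, `D_{SX} Y = p_N [SX, Y]`, and `g` does not see `p_N`, so `D_{SX} g` and
`L_{SX} g` agree. Replacing `g` by `γ` is harmless because all arguments are horizontal. Expanding
`SX (γ(Y, Z))` by metricity and writing `∇_{SX} Y - [SX, Y] = ∇_Y (SX)` by vanishing torsion gives
the expression with `∇` (`covDerivForm_eq_nabla`).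

The Hessian of a Lagrangian is its second derivative in `y`, so the Cartan tensor of a Lagrange
metric is a third derivative in `y`, hence totally symmetric. Conversely, if `C(X, Y, Z) = C(Y, X,
Z)`, the Poincaré lemma in `y` with parameter `x`, applied twice, writes `G` locally as a
`y`-Hessian (`exists_partial_hessian`, `isLocallyLagrange_of_cartanTensor_symm`). Finally `γ`
determines `g` (`form_unique`), so being locally Lagrange-Riemann is a condition on the given `g`.
-/

noncomputable section

namespace LagrangeGeometry

/-! ### Smooth dependence of integrals on parameters. -/

section ParametricIntegral

universe u

variable {H V : Type u} [NormedAddCommGroup H] [NormedSpace ℝ H] [FiniteDimensional ℝ H]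
  [NormedAddCommGroup V] [NormedSpace ℝ V]

/-- Differentiation under the integral sign, for an integrand that is `C¹` near `{x₀} × [0, 1]`. -/
theorem hasFDerivAt_intervalIntegral_of_contDiffOn {f : H × ℝ → V} {O : Set (H × ℝ)}
    (hO : IsOpen O) (hf : ContDiffOn ℝ 1 f O) {U : Set H} (hU : IsOpen U)
    (hUO : U ×ˢ Icc (0 : ℝ) 1 ⊆ O) {x₀ : H} (hx₀ : x₀ ∈ U) :
    HasFDerivAt (fun x ↦ ∫ t in (0 : ℝ)..1, f (x, t))
      (∫ t in (0 : ℝ)..1, (fderiv ℝ f (x₀, t)).comp (ContinuousLinearMap.inl ℝ H ℝ)) x₀ := by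
  have hsub : ∀ t ∈ uIoc (0 : ℝ) 1, t ∈ Icc (0 : ℝ) 1 := by
    intro t ht
    rw [uIoc_of_le zero_le_one] at ht
    exact ⟨ht.1.le, ht.2⟩
  have hcf : ContinuousOn (fun q ↦ (fderiv ℝ f q).comp (ContinuousLinearMap.inl ℝ H ℝ)) O :=
    (hf.continuousOn_fderiv_of_isOpen hO le_rfl).clm_comp continuousOn_const
  have hline : ∀ x ∈ U, ContinuousOn (fun t : ℝ ↦ f (x, t)) (Icc 0 1) := fun x hx ↦
    hf.continuousOn.comp (by fun_prop) fun t ht ↦ hUO ⟨hx, ht⟩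
  -- A closed ball in the finite-dimensional `H` is compact, so the partial derivative is bounded on
  -- its product with `[0, 1]`; this constant is the dominating function.
  obtain ⟨ε, hε, hεU⟩ := Metric.nhds_basis_closedBall.mem_iff.1 (hU.mem_nhds hx₀)
  have hK : IsCompact (Metric.closedBall x₀ ε ×ˢ Icc (0 : ℝ) 1) :=
    (isCompact_closedBall x₀ ε).prod isCompact_Icc
  have hKO : Metric.closedBall x₀ ε ×ˢ Icc (0 : ℝ) 1 ⊆ O :=
    (prod_mono hεU subset_rfl).trans hUO
  obtain ⟨C, hC⟩ := hK.exists_bound_of_continuousOn (hcf.mono hKO)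
  refine intervalIntegral.hasFDerivAt_integral_of_dominated_of_fderiv_le
    (F' := fun x t ↦ (fderiv ℝ f (x, t)).comp (ContinuousLinearMap.inl ℝ H ℝ))
    (bound := fun _ ↦ C) (Metric.closedBall_mem_nhds x₀ hε) ?_ ?_ ?_ ?_ ?_ ?_
  · filter_upwards [hU.mem_nhds hx₀] with x hx
    exact ((hline x hx).mono hsub).aestronglyMeasurable measurableSet_uIoc
  · exact (by simpa [uIcc_of_le] using hline x₀ hx₀ : ContinuousOn _ _).intervalIntegrable
  · refine ContinuousOn.aestronglyMeasurable ?_ measurableSet_uIoc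
    exact hcf.comp (by fun_prop) fun t ht ↦ hUO ⟨hx₀, hsub t ht⟩
  · exact .of_forall fun t ht x hx ↦ hC (x, t) ⟨hx, hsub t ht⟩
  · exact intervalIntegrable_const
  · refine .of_forall fun t ht x hx ↦ ?_
    have hxt : (x, t) ∈ O := hKO ⟨hx, hsub t ht⟩
    have h1 : HasFDerivAt f (fderiv ℝ f (x, t)) (x, t) :=
      ((hf.contDiffAt (hO.mem_nhds hxt)).differentiableAt one_ne_zero).hasFDerivAt
    exact h1.comp x (hasFDerivAt_prodMk_left x t)

/-- An integral over `[0, 1]` depends smoothly on parameters if its integrand does. -/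
theorem contDiffOn_intervalIntegral {f : H × ℝ → V} {O : Set (H × ℝ)}
    (hO : IsOpen O) (hf : ContDiffOn ℝ ∞ f O) {U : Set H} (hU : IsOpen U)
    (hUO : U ×ˢ Icc (0 : ℝ) 1 ⊆ O) :
    ContDiffOn ℝ ∞ (fun x ↦ ∫ t in (0 : ℝ)..1, f (x, t)) U := by
  rw [contDiffOn_infty]
  intro n
  -- The induction on the order of smoothness replaces the target `V` by `H →L[ℝ] V`. The common
  -- universe of `H` and `V` keeps this target in the range of the induction.
  have key : ∀ {W : Type u} [NormedAddCommGroup W] [NormedSpace ℝ W] {f : H × ℝ → W},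
      ContDiffOn ℝ ∞ f O →
      DifferentiableOn ℝ (fun x ↦ ∫ t in (0 : ℝ)..1, f (x, t)) U := fun hf x hx ↦
    (hasFDerivAt_intervalIntegral_of_contDiffOn hO (hf.of_le (by simp)) hU hUO
      hx).differentiableAt.differentiableWithinAt
  induction n generalizing V with
  | zero => exact contDiffOn_zero.2 (key hf).continuousOn
  | succ n ih =>
    rw [Nat.cast_succ, contDiffOn_succ_iff_fderiv_of_isOpen hU]
    refine ⟨key hf, by simp, ?_⟩
    refine (ih (f := fun q ↦ (fderiv ℝ f q).comp (ContinuousLinearMap.inl ℝ H ℝ))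
      ((hf.fderiv_of_isOpen hO (by simp)).clm_comp contDiffOn_const)).congr fun x hx ↦ ?_
    exact (hasFDerivAt_intervalIntegral_of_contDiffOn hO (hf.of_le (by simp)) hU hUO hx).fderiv

end ParametricIntegral

/-! ### The Poincaré lemma with parameters, and partial Hessians. -/

section Poincare

universe u

variable {X Y V : Type u} [NormedAddCommGroup X] [NormedSpace ℝ X] [FiniteDimensional ℝ X]
  [NormedAddCommGroup Y] [NormedSpace ℝ Y] [FiniteDimensional ℝ Y]
  [NormedAddCommGroup V] [NormedSpace ℝ V] [CompleteSpace V]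

/-- The Poincaré lemma for `1`-forms in the variable `y`, depending smoothly on a parameter `x`. -/
theorem exists_partial_primitive {η : X × Y → Y →L[ℝ] V} {z₀ : X × Y} {ε : ℝ}
    (hη : ContDiffOn ℝ ∞ η (Metric.ball z₀ ε))
    (hsymm : ∀ z ∈ Metric.ball z₀ ε, ∀ k l,
      fderiv ℝ η z (0, k) l = fderiv ℝ η z (0, l) k) :
    ∃ F : X × Y → V, ContDiffOn ℝ ∞ F (Metric.ball z₀ ε) ∧
      ∀ z ∈ Metric.ball z₀ ε, ∀ k, fderiv ℝ F z (0, k) = η z k := by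
  set B := Metric.ball z₀ ε with hB
  -- The contraction moves only `y` towards `y₀`. A ball for the sup norm of the product is stable
  -- under it for `t ∈ [0, 1]`. The primitive is `∫₀¹ η(x, y₀ + t(y - y₀))(y - y₀) dt`.
  let c : (X × Y) × ℝ → X × Y := fun q ↦ (q.1.1, z₀.2 + q.2 • (q.1.2 - z₀.2))
  have hc : ContDiff ℝ ∞ c := by fun_prop
  let O := c ⁻¹' B
  have hO : IsOpen O := Metric.isOpen_ball.preimage hc.continuous
  have hBO : B ×ˢ Icc (0 : ℝ) 1 ⊆ O := by
    rintro ⟨z, t⟩ ⟨hz, ht⟩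
    rw [hB, Metric.mem_ball, Prod.dist_eq, max_lt_iff] at hz
    change c (z, t) ∈ Metric.ball z₀ ε
    rw [Metric.mem_ball, Prod.dist_eq, max_lt_iff]
    refine ⟨hz.1, lt_of_le_of_lt ?_ hz.2⟩
    simp only [c, dist_eq_norm, add_sub_cancel_left, norm_smul, Real.norm_eq_abs,
      abs_of_nonneg ht.1]
    exact mul_le_of_le_one_left (norm_nonneg _) ht.2
  let f : (X × Y) × ℝ → V := fun q ↦ η (c q) (q.1.2 - z₀.2)
  have hf : ContDiffOn ℝ ∞ f O :=
    (hη.comp hc.contDiffOn fun _ h ↦ h).clm_apply (by fun_prop)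
  refine ⟨fun z ↦ ∫ t in (0 : ℝ)..1, f (z, t),
    contDiffOn_intervalIntegral hO hf Metric.isOpen_ball hBO, fun z hz k ↦ ?_⟩
  rw [(hasFDerivAt_intervalIntegral_of_contDiffOn hO (hf.of_le (by simp)) Metric.isOpen_ball hBO
    hz).fderiv]
  have hsub : uIcc (0 : ℝ) 1 = Icc 0 1 := uIcc_of_le zero_le_one
  have hηd : ∀ t ∈ Icc (0 : ℝ) 1, DifferentiableAt ℝ η (c (z, t)) := fun t ht ↦
    (hη.contDiffAt (Metric.isOpen_ball.mem_nhds (hBO ⟨hz, ht⟩))).differentiableAt (by simp)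
  -- By closedness, the derivative of the integrand in the direction `k` is the `t`-derivative of `t
  -- • η(c(z, t)) k`, whose boundary values are `0` and `η(z) k`.
  have hder : ∀ t ∈ Icc (0 : ℝ) 1, HasDerivAt (fun t ↦ t • η (c (z, t)) k)
      ((fderiv ℝ f (z, t)).comp (ContinuousLinearMap.inl ℝ (X × Y) ℝ) (0, k)) t := by
    intro t ht
    have h1 : HasDerivAt (fun t ↦ c (z, t)) ((0 : X), z.2 - z₀.2) t := by
      refine (hasDerivAt_const t z.1).prodMk ?_
      simpa using ((hasDerivAt_id t).smul_const (z.2 - z₀.2)).const_add z₀.2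
    have h2 : HasDerivAt (fun t ↦ η (c (z, t)) k)
        (fderiv ℝ η (c (z, t)) (0, z.2 - z₀.2) k) t :=
      ((ContinuousLinearMap.apply ℝ V k).hasFDerivAt.comp_hasDerivAt t
        ((hηd t ht).hasFDerivAt.comp_hasDerivAt t h1))
    have h3 := (hasDerivAt_id t).smul h2
    refine h3.congr_deriv ?_
    have h4 : HasDerivAt (fun s : ℝ ↦ (z + s • ((0 : X), k), t)) (((0 : X), k), (0 : ℝ)) 0 := by
      refine HasDerivAt.prodMk ?_ (hasDerivAt_const _ _)
      simpa using ((hasDerivAt_id (0 : ℝ)).smul_const ((0 : X), k)).const_add z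
    have h5 : HasDerivAt (fun s : ℝ ↦ c (z + s • ((0 : X), k), t)) ((0 : X), t • k) 0 := by
      have : HasDerivAt (fun s : ℝ ↦ (z.1, z₀.2 + t • ((z.2 - z₀.2) + s • k)))
          ((0 : X), t • k) 0 := by
        refine (hasDerivAt_const _ _).prodMk ?_
        have := (((hasDerivAt_id (0 : ℝ)).smul_const k).const_add (z.2 - z₀.2)).const_smul t
        simpa using this.const_add z₀.2
      refine this.congr_of_eventuallyEq (.of_forall fun s ↦ ?_)
      simp only [c, Prod.fst_add, Prod.snd_add, Prod.smul_fst, Prod.smul_snd, smul_zero, add_zero]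
      congr 3
      abel
    have h6 : HasDerivAt (fun s : ℝ ↦ f (z + s • ((0 : X), k), t))
        (fderiv ℝ η (c (z, t)) (0, t • k) (z.2 - z₀.2) + η (c (z, t)) k) 0 := by
      have hz0 : c (z + (0 : ℝ) • ((0 : X), k), t) = c (z, t) := by simp
      have h7 : HasDerivAt (fun s : ℝ ↦ η (c (z + s • ((0 : X), k), t)))
          (fderiv ℝ η (c (z, t)) (0, t • k)) 0 :=
        (by rw [hz0]; exact (hηd t ht).hasFDerivAt : HasFDerivAt η (fderiv ℝ η (c (z, t)))
          (c (z + (0 : ℝ) • ((0 : X), k), t))).comp_hasDerivAt (0 : ℝ) h5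
      have h8 : HasDerivAt (fun s : ℝ ↦ (z + s • ((0 : X), k)).2 - z₀.2) k 0 := by
        simpa using (((hasDerivAt_id (0 : ℝ)).smul_const k).const_add z.2).sub_const z₀.2
      have := h7.clm_apply h8
      rw [hz0] at this
      exact HasDerivAt.congr_deriv (f := fun s : ℝ ↦ f (z + s • ((0 : X), k), t)) this (by simp)
    have h9 : HasFDerivAt f (fderiv ℝ f (z, t)) (z + (0 : ℝ) • ((0 : X), k), t) := by
      have : (z + (0 : ℝ) • ((0 : X), k), t) = (z, t) := by simp
      rw [this]
      exact ((hf.contDiffAt (hO.mem_nhds (hBO ⟨hz, ht⟩))).differentiableAt (by simp)).hasFDerivAt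
    have h10 : HasDerivAt (fun s : ℝ ↦ f (z + s • ((0 : X), k), t))
        (fderiv ℝ f (z, t) ((0, k), 0)) 0 := 
      HasFDerivAt.comp_hasDerivAt (f := fun s : ℝ ↦ (z + s • ((0 : X), k), t)) (0 : ℝ) h9 h4
    replace h10 := h10.unique h6
    have h11 : fderiv ℝ η (c (z, t)) (0, t • k) = t • fderiv ℝ η (c (z, t)) (0, k) := by
      rw [← map_smul]; simp
    -- Closedness enters here, exchanging `k` with the radial direction `y - y₀`.
    rw [h11, smul_apply, hsymm _ (hBO ⟨hz, ht⟩)] at h10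
    simpa [add_comm] using h10.symm
  have hcont : ContinuousOn (fun t ↦ (fderiv ℝ f (z, t)).comp
      (ContinuousLinearMap.inl ℝ (X × Y) ℝ)) (uIcc 0 1) := by
    rw [hsub]
    refine ContinuousOn.clm_comp ?_ continuousOn_const
    exact (hf.continuousOn_fderiv_of_isOpen hO (by simp)).comp (by fun_prop)
      fun t ht ↦ hBO ⟨hz, ht⟩
  rw [ContinuousLinearMap.intervalIntegral_apply hcont.intervalIntegrable,
    intervalIntegral.integral_eq_sub_of_hasDerivAt (fun t ht ↦ hder t (hsub ▸ ht))
      (hcont.clm_apply continuousOn_const).intervalIntegrable]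
  simp [c]

/-- A symmetric matrix of functions of `(x, y)` whose derivatives in `y` are totally symmetric is
locally the Hessian in `y` of a function. -/
theorem exists_partial_hessian {X Y : Type} [NormedAddCommGroup X] [NormedSpace ℝ X]
    [FiniteDimensional ℝ X] [NormedAddCommGroup Y] [NormedSpace ℝ Y] [FiniteDimensional ℝ Y]
    {G : X × Y → Y →L[ℝ] Y →L[ℝ] ℝ} {z₀ : X × Y} {ε : ℝ}
    (hG : ContDiffOn ℝ ∞ G (Metric.ball z₀ ε))
    (hsymm : ∀ z ∈ Metric.ball z₀ ε, ∀ k l, G z k l = G z l k)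
    (hcod : ∀ z ∈ Metric.ball z₀ ε, ∀ k l m,
      fderiv ℝ G z (0, k) l m = fderiv ℝ G z (0, l) k m) :
    ∃ F : X × Y → ℝ, ContDiffOn ℝ ∞ F (Metric.ball z₀ ε) ∧
      ∀ z ∈ Metric.ball z₀ ε, ∀ k l, fderiv ℝ (fderiv ℝ F) z (0, k) (0, l) = G z k l := by
  -- `G` is a `1`-form in `y` with values in the dual of `Y`, closed by `hcod`. Its primitive `A` is
  -- again a `1`-form in `y`, closed because `G` is symmetric.
  obtain ⟨A, hA, hAG⟩ := exists_partial_primitive hG fun z hz k l ↦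
    ContinuousLinearMap.ext fun m ↦ hcod z hz k l m
  obtain ⟨F, hF, hFA⟩ := exists_partial_primitive hA fun z hz k l ↦ by
    rw [hAG z hz, hAG z hz, hsymm z hz]
  refine ⟨F, hF, fun z hz k l ↦ ?_⟩
  have hz' := Metric.isOpen_ball.mem_nhds hz
  have hdF : DifferentiableAt ℝ (fderiv ℝ F) z :=
    ((hF.fderiv_of_isOpen (m := ∞) Metric.isOpen_ball (by simp)).contDiffAt hz').differentiableAt
      (by simp)
  have hdA : DifferentiableAt ℝ A z := (hA.contDiffAt hz').differentiableAt (by simp)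
  have h1 : (fun w ↦ fderiv ℝ F w (0, l)) =ᶠ[𝓝 z] fun w ↦ A w l := by
    filter_upwards [hz'] with w hw using hFA w hw l
  have h2 := h1.fderiv_eq (𝕜 := ℝ)
  have h3 : fderiv ℝ (fun w ↦ fderiv ℝ F w (0, l)) z (0, k)
      = fderiv ℝ (fderiv ℝ F) z (0, k) (0, l) := by
    rw [fderiv_clm_apply hdF (by fun_prop)]; simp
  have h4 : fderiv ℝ (fun w ↦ A w l) z (0, k) = fderiv ℝ A z (0, k) l := by
    rw [fderiv_clm_apply hdA (by fun_prop)]; simp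
  rw [← h3, h2, h4, hAG z hz]

end Poincare

/-! ### Vector fields, forms and brackets in a chart. -/

section Coordinates

variable {E : Type*} [NormedAddCommGroup E] [NormedSpace ℝ E]
  {M : Type*} [TopologicalSpace M] [ChartedSpace E M]

/-- The derivative of the chart `φ`, with values in the model space. -/
def chartDeriv (φ : OpenPartialHomeomorph M E) (p : M) : TangentSpace 𝓘(ℝ, E) p →L[ℝ] E :=
  mfderiv 𝓘(ℝ, E) 𝓘(ℝ, E) φ p

/-- The derivative of the inverse of the chart `φ`, defined on the model space. -/
def chartDerivSymm (φ : OpenPartialHomeomorph M E) (p : M) : E →L[ℝ] TangentSpace 𝓘(ℝ, E) p :=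
  (mfderiv 𝓘(ℝ, E) 𝓘(ℝ, E) φ p).inverse

/-- The components of a vector field in the coordinates `φ`. -/
def coordField (φ : OpenPartialHomeomorph M E) (V : VField E M) (z : E) : E :=
  chartDeriv φ (φ.symm z) (V (φ.symm z))

/-- The vector field with constant components in the coordinates `φ`. -/
def constField (φ : OpenPartialHomeomorph M E) (c : E) : VField E M :=
  fun p ↦ chartDerivSymm φ p c

/-- The components of a field of bilinear forms in the coordinates `φ`. -/
def coordForm (φ : OpenPartialHomeomorph M E) (b : BForm E M) (z : E) : E →L[ℝ] E →L[ℝ] ℝ :=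
  (ContinuousLinearMap.precomp ℝ (chartDerivSymm φ (φ.symm z))).comp
    ((b (φ.symm z)).comp (chartDerivSymm φ (φ.symm z)))

theorem coordForm_apply (φ : OpenPartialHomeomorph M E) (b : BForm E M) (z c d : E) :
    coordForm φ b z c d = b (φ.symm z) (constField φ c (φ.symm z)) (constField φ d (φ.symm z)) :=
  rfl

variable {φ : OpenPartialHomeomorph M E}

theorem coordField_apply {p : M} (hp : p ∈ φ.source) (V : VField E M) :
    coordField φ V (φ p) = chartDeriv φ p (V p) := by
  rw [coordField, φ.left_inv hp]

section Algebra

variable (hφ : φ ∈ IsManifold.maximalAtlas 𝓘(ℝ, E) ∞ M)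

include hφ

theorem mdifferentiable_of_mem_maximalAtlas : φ.MDifferentiable 𝓘(ℝ, E) 𝓘(ℝ, E) :=
  ⟨(contMDiffOn_of_mem_maximalAtlas hφ).mdifferentiableOn (by simp),
    (contMDiffOn_symm_of_mem_maximalAtlas hφ).mdifferentiableOn (by simp)⟩

theorem isInvertible_mfderiv {p : M} (hp : p ∈ φ.source) :
    (mfderiv 𝓘(ℝ, E) 𝓘(ℝ, E) φ p).IsInvertible :=
  ⟨(mdifferentiable_of_mem_maximalAtlas hφ).mfderiv hp, rfl⟩

theorem isInvertible_mfderiv_symm {z : E} (hz : z ∈ φ.target) :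
    (mfderiv 𝓘(ℝ, E) 𝓘(ℝ, E) φ.symm z).IsInvertible :=
  ⟨(mdifferentiable_of_mem_maximalAtlas hφ).symm.mfderiv hz, rfl⟩

theorem chartDeriv_chartDerivSymm {p : M} (hp : p ∈ φ.source) (c : E) :
    chartDeriv φ p (chartDerivSymm φ p c) = c :=
  ((isInvertible_mfderiv hφ hp).inverse_apply_eq.1 rfl).symm

theorem chartDerivSymm_chartDeriv {p : M} (hp : p ∈ φ.source) (v : TangentSpace 𝓘(ℝ, E) p) :
    chartDerivSymm φ p (chartDeriv φ p v) = v :=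
  (isInvertible_mfderiv hφ hp).inverse_apply_eq.2 rfl

theorem mpullback_symm_apply (V : VField E M) {z : E} (hz : z ∈ φ.target) :
    mpullback 𝓘(ℝ, E) 𝓘(ℝ, E) φ.symm V z = coordField φ V z := by
  have hd := mdifferentiable_of_mem_maximalAtlas hφ
  have : (mfderiv 𝓘(ℝ, E) 𝓘(ℝ, E) φ.symm z).inverse
      = mfderiv 𝓘(ℝ, E) 𝓘(ℝ, E) φ (φ.symm z) := by
    apply ContinuousLinearMap.inverse_eq
    · have := hd.symm_comp_deriv (φ.map_target hz)
      rwa [φ.right_inv hz] at this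
    · exact hd.comp_symm_deriv hz
  simp only [mpullback_apply, this]
  rfl

theorem coordField_constField (c : E) {z : E} (hz : z ∈ φ.target) :
    coordField φ (constField φ c) z = c :=
  chartDeriv_chartDerivSymm hφ (φ.map_target hz) c

theorem coordForm_chartDeriv (b : BForm E M) {p : M} (hp : p ∈ φ.source)
    (u v : TangentSpace 𝓘(ℝ, E) p) :
    coordForm φ b (φ p) (chartDeriv φ p u) (chartDeriv φ p v) = b p u v := by
  -- The base point is generalized because `φ.symm (φ p)` is only propositionally equal to `p`, and
  -- the tangent spaces depend on it.
  have h : ∀ q (_ : q = p), b q (constField φ (chartDeriv φ p u) q)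
      (constField φ (chartDeriv φ p v) q) = b p u v := by
    rintro q rfl
    simp only [constField, chartDerivSymm_chartDeriv hφ hp]
  exact h _ (φ.left_inv hp)

theorem coordForm_coordField (b : BForm E M) (Y Z : VField E M) {z : E} (hz : z ∈ φ.target) :
    coordForm φ b z (coordField φ Y z) (coordField φ Z z)
      = b (φ.symm z) (Y (φ.symm z)) (Z (φ.symm z)) := by
  have := coordForm_chartDeriv hφ b (φ.map_target hz) (Y (φ.symm z)) (Z (φ.symm z))
  rwa [φ.right_inv hz] at this

theorem dirDeriv_eq_fderiv (V : VField E M) {f : M → ℝ} {p : M} (hp : p ∈ φ.source)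
    (hf : MDifferentiableAt 𝓘(ℝ, E) 𝓘(ℝ, ℝ) f p) :
    dirDeriv V f p = fderiv ℝ (f ∘ φ.symm) (φ p) (coordField φ V (φ p)) := by
  have hd := mdifferentiable_of_mem_maximalAtlas hφ
  have hcomp : MDifferentiableAt 𝓘(ℝ, E) 𝓘(ℝ, ℝ) (f ∘ φ.symm) (φ p) :=
    MDifferentiableAt.comp_of_eq (φ p) hf (hd.symm.mdifferentiableAt (φ.map_source hp))
      (φ.left_inv hp)
  have heq : f =ᶠ[𝓝 p] (f ∘ φ.symm) ∘ φ := by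
    filter_upwards [φ.open_source.mem_nhds hp] with q hq
    simp [φ.left_inv hq]
  have h1 := mvfderiv_comp_apply p (g := f ∘ φ.symm) hcomp (hd.mdifferentiableAt hp) (V p)
  rw [coordField_apply hp]
  rw [dirDeriv, mvfderiv, heq.mfderiv_eq]
  have h2 : mfderiv 𝓘(ℝ, E) 𝓘(ℝ, ℝ) (f ∘ φ.symm) (φ p) = fderiv ℝ (f ∘ φ.symm) (φ p) :=
    mfderiv_eq_fderiv
  have h3 : ∀ c : E, mvfderiv 𝓘(ℝ, E) (f ∘ φ.symm) (φ p) c = fderiv ℝ (f ∘ φ.symm) (φ p) c :=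
    fun c ↦ congrArg (fun A : E →L[ℝ] ℝ ↦ A c) h2
  exact h1.trans (h3 _)

theorem coordField_eventuallyEq (V : VField E M) {p : M} (hp : p ∈ φ.source) :
    coordField φ V =ᶠ[𝓝 (φ p)] (mpullback 𝓘(ℝ, E) 𝓘(ℝ, E) φ.symm V : VField E E) := by
  filter_upwards [φ.open_target.mem_nhds (φ.map_source hp)] with z hz
  exact (mpullback_symm_apply hφ V hz).symm

end Algebra

section Calculus

variable [IsManifold 𝓘(ℝ, E) ∞ M]

/-- The vector field `V` is differentiable at `p`. -/
def DiffAt (V : VField E M) (p : M) : Prop :=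
  MDifferentiableAt 𝓘(ℝ, E) 𝓘(ℝ, E).tangent
    (fun x ↦ (TotalSpace.mk' E x (V x) : TangentBundle 𝓘(ℝ, E) M)) p

theorem SmoothOn.diffAt {V : VField E M} {W : Set M} (hV : SmoothOn V W) (hW : IsOpen W) {p : M}
    (hp : p ∈ W) : DiffAt V p :=
  (hV.contMDiffAt (hW.mem_nhds hp)).mdifferentiableAt (by simp)

theorem DiffAt.differentiableAt {F : VField E E} {z : E} (hF : DiffAt F z) :
    DifferentiableAt ℝ (F : E → E) z := by
  refine mdifferentiableAt_iff_differentiableAt.1 ?_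
  exact ((contMDiff_snd_tangentBundle_modelSpace (n := 1) E 𝓘(ℝ, E)).mdifferentiableAt
    one_ne_zero).comp z hF

theorem mdifferentiableAt_form {b : BForm E M} (hb : SmoothForm b) {Y Z : VField E M} {p : M}
    (hY : DiffAt Y p) (hZ : DiffAt Z p) :
    MDifferentiableAt 𝓘(ℝ, E) 𝓘(ℝ, ℝ) (fun x ↦ b x (Y x) (Z x)) p := by
  have : MDifferentiableAt 𝓘(ℝ, E) (𝓘(ℝ, E).prod 𝓘(ℝ, ℝ))
      (fun x ↦ TotalSpace.mk' ℝ (E := Bundle.Trivial M ℝ) x (b x (Y x) (Z x))) p := by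
    apply MDifferentiableAt.clm_bundle_apply₂ (F₁ := E) (F₂ := E)
    · exact (hb p).mdifferentiableAt (by simp)
    · exact hY
    · exact hZ
  simp only [mdifferentiableAt_totalSpace] at this
  exact this.2

theorem contMDiffOn_form {b : BForm E M} (hb : SmoothForm b) {Y Z : VField E M} {W : Set M}
    (hY : SmoothOn Y W) (hZ : SmoothOn Z W) :
    ContMDiffOn 𝓘(ℝ, E) 𝓘(ℝ, ℝ) ∞ (fun x ↦ b x (Y x) (Z x)) W := by
  intro p hp
  have : ContMDiffWithinAt 𝓘(ℝ, E) (𝓘(ℝ, E).prod 𝓘(ℝ, ℝ)) ∞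
      (fun x ↦ TotalSpace.mk' ℝ (E := Bundle.Trivial M ℝ) x (b x (Y x) (Z x))) W p := by
    apply ContMDiffWithinAt.clm_bundle_apply₂ (F₁ := E) (F₂ := E)
    · exact (hb p).contMDiffWithinAt
    · exact hY p hp
    · exact hZ p hp
  simp only [contMDiffWithinAt_totalSpace] at this
  exact this.2

theorem SmoothOn.app {T : EndField E M} (hT : SmoothEnd T) {X : VField E M} {W : Set M}
    (hX : SmoothOn X W) : SmoothOn (fun x ↦ T x (X x)) W :=
  fun p hp ↦ ContMDiffWithinAt.clm_bundle_apply (F₁ := E) (F₂ := E)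
    (hT p).contMDiffWithinAt (hX p hp)

theorem DiffAt.app {T : EndField E M} (hT : SmoothEnd T) {X : VField E M} {p : M}
    (hX : DiffAt X p) : DiffAt (fun x ↦ T x (X x)) p :=
  MDifferentiableAt.clm_bundle_apply (F₁ := E) (F₂ := E)
    ((hT p).mdifferentiableAt (by simp)) hX

variable (hφ : φ ∈ IsManifold.maximalAtlas 𝓘(ℝ, E) ∞ M)

include hφ

variable [CompleteSpace E]

theorem smoothOn_constField (c : E) : SmoothOn (constField φ c) φ.source := by
  let K : VField E E := fun _ ↦ c
  have hK : ContMDiff 𝓘(ℝ, E) 𝓘(ℝ, E).tangent ∞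
      (fun x ↦ (TotalSpace.mk' E x (K x) : TangentBundle 𝓘(ℝ, E) E)) := by
    rw [contMDiff_vectorSpace_iff_contDiff]
    exact contDiff_const
  intro y hy
  exact (ContMDiffAt.mpullback_vectorField_preimage (n := ∞) (m := ∞) (hK _)
    ((contMDiffOn_of_mem_maximalAtlas hφ).contMDiffAt (φ.open_source.mem_nhds hy))
    (isInvertible_mfderiv hφ hy) (by simp)).contMDiffWithinAt

theorem differentiableAt_coordField {V : VField E M} {p : M} (hp : p ∈ φ.source)
    (hV : DiffAt V p) : DifferentiableAt ℝ (coordField φ V) (φ p) := by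
  have h1 : DiffAt (mpullback 𝓘(ℝ, E) 𝓘(ℝ, E) φ.symm V : VField E E) (φ p) := by
    refine MDifferentiableAt.mpullback_vectorField (n := ∞) ?_
      ((contMDiffOn_symm_of_mem_maximalAtlas hφ).contMDiffAt
        (φ.open_target.mem_nhds (φ.map_source hp)))
      (isInvertible_mfderiv_symm hφ (φ.map_source hp)) (ENat.LEInfty.out)
    rw [φ.left_inv hp]
    exact hV
  exact h1.differentiableAt.congr_of_eventuallyEq (coordField_eventuallyEq hφ V hp)

/-- Brackets are natural under pullback by `φ.symm`, and the bracket of the model space is given by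
ordinary derivatives. -/
theorem chartDeriv_mlieBracket {V W : VField E M} {p : M} (hp : p ∈ φ.source) (hV : DiffAt V p)
    (hW : DiffAt W p) :
    chartDeriv φ p (mlieBracket 𝓘(ℝ, E) V W p)
      = fderiv ℝ (coordField φ W) (φ p) (coordField φ V (φ p))
        - fderiv ℝ (coordField φ V) (φ p) (coordField φ W (φ p)) := by
  have htwo : (2 : WithTop ℕ∞) ≤ ∞ := ENat.LEInfty.out
  have hms : minSmoothness ℝ 2 = 2 := by simp
  have : IsManifold 𝓘(ℝ, E) (minSmoothness ℝ 2) M := by rw [hms]; infer_instance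
  have : IsManifold 𝓘(ℝ, E) (minSmoothness ℝ 2) E := by infer_instance
  have hz := φ.map_source hp
  have h := mpullback_mlieBracket (I := 𝓘(ℝ, E)) (I' := 𝓘(ℝ, E)) (f := φ.symm) (V := V) (W := W)
    (x₀ := φ p) (n := ∞) (by rw [φ.left_inv hp]; exact hV) (by rw [φ.left_inv hp]; exact hW)
    ((contMDiffOn_symm_of_mem_maximalAtlas hφ).contMDiffAt (φ.open_target.mem_nhds hz))
    (by simpa using htwo)
  rw [mpullback_symm_apply hφ _ hz, coordField_apply hp, ← mlieBracketWithin_univ (V := mpullback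
    𝓘(ℝ, E) 𝓘(ℝ, E) φ.symm V), mlieBracketWithin_eq_lieBracketWithin] at h
  refine h.trans ?_
  have h2 : lieBracket ℝ (mpullback 𝓘(ℝ, E) 𝓘(ℝ, E) φ.symm V : E → E)
      (mpullback 𝓘(ℝ, E) 𝓘(ℝ, E) φ.symm W : E → E) (φ p)
      = lieBracket ℝ (coordField φ V) (coordField φ W) (φ p) :=
    ((coordField_eventuallyEq hφ V hp).lieBracket_vectorField_eq
      (coordField_eventuallyEq hφ W hp)).symm
  have h3 : lieBracketWithin ℝ (mpullback 𝓘(ℝ, E) 𝓘(ℝ, E) φ.symm V : E → E)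
      (mpullback 𝓘(ℝ, E) 𝓘(ℝ, E) φ.symm W : E → E) univ (φ p)
      = lieBracket ℝ (mpullback 𝓘(ℝ, E) 𝓘(ℝ, E) φ.symm V : E → E)
      (mpullback 𝓘(ℝ, E) 𝓘(ℝ, E) φ.symm W : E → E) (φ p) :=
    congrFun (lieBracketWithin_univ (𝕜 := ℝ) (E := E)) (φ p)
  exact h3.trans h2

/-- The coordinate expression of a smooth field of bilinear forms is smooth. -/
theorem contDiffOn_coordForm [FiniteDimensional ℝ E] {b : BForm E M} (hb : SmoothForm b) :
    ContDiffOn ℝ ∞ (coordForm φ b) φ.target := by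
  rw [contDiffOn_clm_apply]
  intro c
  rw [contDiffOn_clm_apply]
  intro d
  have h := contMDiffOn_form hb (smoothOn_constField hφ c) (smoothOn_constField hφ d)
  exact (h.comp (contMDiffOn_symm_of_mem_maximalAtlas hφ) fun z hz ↦ φ.map_target hz).contDiffOn

end Calculus

end Coordinates

/-! ### Adapted charts: Lie derivatives and Hessians in coordinates. -/

section Adapted

variable {E : Type*} [NormedAddCommGroup E] [NormedSpace ℝ E]
  {M : Type*} [TopologicalSpace M] [ChartedSpace E M]

/-- The endomorphism `(x, y) ↦ (0, x)`, in the coordinates `(x, y)` given by `L`. -/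
def verticalShift {n : ℕ} (L : E ≃L[ℝ] (Fin n → ℝ) × (Fin n → ℝ)) : E →L[ℝ] E :=
  (L.symm : (Fin n → ℝ) × (Fin n → ℝ) →L[ℝ] E).comp
    (((ContinuousLinearMap.inr ℝ (Fin n → ℝ) (Fin n → ℝ)).comp
      (ContinuousLinearMap.fst ℝ (Fin n → ℝ) (Fin n → ℝ))).comp (L : E →L[ℝ] _))

theorem verticalShift_apply {n : ℕ} (L : E ≃L[ℝ] (Fin n → ℝ) × (Fin n → ℝ)) (c : E) :
    verticalShift L c = L.symm (0, (L c).1) := rfl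

theorem verticalShift_verticalShift {n : ℕ} (L : E ≃L[ℝ] (Fin n → ℝ) × (Fin n → ℝ)) (c : E) :
    verticalShift L (verticalShift L c) = 0 := by
  simp [verticalShift_apply]

/-- The coordinate form of `ker S = im S`. -/
theorem exists_eq_verticalShift {n : ℕ} (L : E ≃L[ℝ] (Fin n → ℝ) × (Fin n → ℝ)) {c : E}
    (hc : verticalShift L c = 0) : ∃ d, c = verticalShift L d := by
  refine ⟨L.symm ((L c).2, 0), ?_⟩
  have h : (L c).1 = 0 := by
    have := congrArg (fun e ↦ (L e).2) hc
    simpa [verticalShift_apply] using this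
  rw [verticalShift_apply, L.apply_symm_apply, ContinuousLinearEquiv.eq_symm_apply]
  exact Prod.ext h rfl

theorem coordForm_symm {b : BForm E M} (hb : ∀ x u v, b x u v = b x v u)
    (φ : OpenPartialHomeomorph M E) (z c d : E) : coordForm φ b z c d = coordForm φ b z d c :=
  hb _ _ _

variable [IsManifold 𝓘(ℝ, E) ∞ M]

/-- `φ` is a chart such that the coordinates `L ∘ φ = (x, y)` are adapted to the tangent
structure: `S (∂/∂xⁱ) = ∂/∂yⁱ` and `S (∂/∂yⁱ) = 0`. -/
structure IsAdaptedChart (T : TangentStructure E M) (φ : OpenPartialHomeomorph M E) {n : ℕ}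
    (L : E ≃L[ℝ] (Fin n → ℝ) × (Fin n → ℝ)) : Prop where
  mem_maximalAtlas : φ ∈ IsManifold.maximalAtlas 𝓘(ℝ, E) ∞ M
  chartDeriv_S : ∀ p ∈ φ.source, ∀ v, chartDeriv φ p (T.S p v) = verticalShift L (chartDeriv φ p v)

theorem exists_isAdaptedChart (T : TangentStructure E M) (p : M) :
    ∃ (φ : OpenPartialHomeomorph M E) (n : ℕ) (L : E ≃L[ℝ] (Fin n → ℝ) × (Fin n → ℝ)),
      p ∈ φ.source ∧ IsAdaptedChart T φ L := by
  obtain ⟨φ, hφ, hp, n, L, hL⟩ := T.integrable p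
  refine ⟨φ, n, L, hp, hφ, fun q hq v ↦ L.injective ?_⟩
  rw [verticalShift_apply, L.apply_symm_apply]
  exact hL q hq v

theorem TangentStructure.mem_range_iff (T : TangentStructure E M) {p : M}
    {v : TangentSpace 𝓘(ℝ, E) p} : v ∈ (T.S p).range ↔ T.S p v = 0 := by
  rw [T.range_eq_ker, LinearMap.mem_ker]
  rfl

variable {T : TangentStructure E M} {φ : OpenPartialHomeomorph M E} {n : ℕ}
    {L : E ≃L[ℝ] (Fin n → ℝ) × (Fin n → ℝ)} (hφ : IsAdaptedChart T φ L)

include hφ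

namespace IsAdaptedChart

theorem mem_range_iff {p : M} (hp : p ∈ φ.source) {v : TangentSpace 𝓘(ℝ, E) p} :
    v ∈ (T.S p).range ↔ verticalShift L (chartDeriv φ p v) = 0 := by
  rw [T.mem_range_iff, ← hφ.chartDeriv_S p hp]
  constructor
  · intro h
    rw [h, map_zero]
  · intro h
    rw [← chartDerivSymm_chartDeriv hφ.mem_maximalAtlas hp (T.S p v), h, map_zero]

theorem coordField_app (X : VField E M) {z : E} (hz : z ∈ φ.target) :
    coordField φ (T.app X) z = verticalShift L (coordField φ X z) :=
  hφ.chartDeriv_S _ (φ.map_target hz) _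

theorem coordForm_verticalShift_left {b : BForm E M} (hb : ∀ x u v, b x (T.S x u) v = 0) {z : E}
    (hz : z ∈ φ.target) (c d : E) : coordForm φ b z (verticalShift L c) d = 0 := by
  have h1 := hφ.coordField_app (constField φ c) hz
  rw [coordField_constField hφ.mem_maximalAtlas c hz] at h1
  rw [← h1, ← coordField_constField hφ.mem_maximalAtlas d hz,
    coordForm_coordField hφ.mem_maximalAtlas b _ _ hz]
  exact hb _ _ _

section Calculus

variable [FiniteDimensional ℝ E]

/-- In coordinates, the Lie derivative of a transversal tensor along a vertical vector field is the
derivative of its components. -/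
theorem lieDerivForm_eq {b : BForm E M} (hb : SmoothForm b)
    (hsymm : ∀ x u v, b x u v = b x v u) (hvert : ∀ x u v, b x (T.S x u) v = 0)
    {V Y Z : VField E M} {p : M} (hp : p ∈ φ.source)
    (hV : DiffAt V p) (hVv : ∀ᶠ q in 𝓝 p, V q ∈ (T.S q).range) (hY : DiffAt Y p)
    (hZ : DiffAt Z p) :
    lieDerivForm V b Y Z p = fderiv ℝ (coordForm φ b) (φ p) (chartDeriv φ p (V p))
      (chartDeriv φ p (Y p)) (chartDeriv φ p (Z p)) := by
  have : CompleteSpace E := FiniteDimensional.complete ℝ E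
  have ha := hφ.mem_maximalAtlas
  have hz := φ.map_source hp
  have hV' := differentiableAt_coordField ha hp hV
  have hY' := differentiableAt_coordField ha hp hY
  have hZ' := differentiableAt_coordField ha hp hZ
  have hG : DifferentiableAt ℝ (coordForm φ b) (φ p) :=
    ((contDiffOn_coordForm ha hb).contDiffAt (φ.open_target.mem_nhds hz)).differentiableAt
      (by simp)
  have h1 : (fun x ↦ b x (Y x) (Z x)) ∘ φ.symm =ᶠ[𝓝 (φ p)]
      fun z ↦ coordForm φ b z (coordField φ Y z) (coordField φ Z z) := by
    filter_upwards [φ.open_target.mem_nhds hz] with z hz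
    exact (coordForm_coordField ha b Y Z hz).symm
  have h2 : (fun z ↦ verticalShift L (coordField φ V z)) =ᶠ[𝓝 (φ p)] fun _ ↦ 0 := by
    have : Filter.Tendsto φ.symm (𝓝 (φ p)) (𝓝 p) := by
      have := φ.continuousAt_symm hz
      rwa [ContinuousAt, φ.left_inv hp] at this
    filter_upwards [φ.open_target.mem_nhds hz, this.eventually hVv] with z hz hzV
    exact (hφ.mem_range_iff (φ.map_target hz)).1 hzV
  -- Differentiating `J V = 0`, valid near `φ p`, shows that `DV` takes vertical values. The form
  -- kills these, so only `DY·V` and `DZ·V` survive from the brackets, and they cancel the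
  -- product-rule terms.
  have h3 : ∀ c, ∃ d, fderiv ℝ (coordField φ V) (φ p) c = verticalShift L d := fun c ↦ by
    apply exists_eq_verticalShift
    have h4 := ((verticalShift L).hasFDerivAt.comp _ hV'.hasFDerivAt).unique
      ((hasFDerivAt_const (0 : E) (φ p)).congr_of_eventuallyEq h2)
    exact congrArg (fun A : E →L[ℝ] E ↦ A c) h4
  obtain ⟨dY, hdY⟩ := h3 (coordField φ Y (φ p))
  obtain ⟨dZ, hdZ⟩ := h3 (coordField φ Z (φ p))
  rw [lieDerivForm, dirDeriv_eq_fderiv ha V hp (mdifferentiableAt_form hb hY hZ), h1.fderiv_eq,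
    ← coordForm_chartDeriv ha b hp, ← coordForm_chartDeriv ha b hp,
    chartDeriv_mlieBracket ha hp hV hY, chartDeriv_mlieBracket ha hp hV hZ, hdY, hdZ,
    fderiv_clm_apply (hG.clm_apply hY') hZ', fderiv_clm_apply hG hY']
  simp only [← coordField_apply hp, map_sub, sub_apply, add_apply,
    ContinuousLinearMap.comp_apply, ContinuousLinearMap.flip_apply,
    hφ.coordForm_verticalShift_left hvert hz,
    coordForm_symm hsymm φ _ (coordField φ Y (φ p)) (verticalShift L dZ)]
  ring

/-- In adapted coordinates, a foliated vector field has the form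
`ξⁱ(x) ∂/∂xⁱ + ηⁱ(x, y) ∂/∂yⁱ`. -/
theorem verticalShift_fderiv_of_isFoliatedOn {X : VField E M} {W : Set M}
    (hX : IsFoliatedOn T X W) {p : M} (hp : p ∈ φ.source) (hpW : p ∈ W) (c : E) :
    verticalShift L (fderiv ℝ (coordField φ X) (φ p) (verticalShift L c)) = 0 := by
  have : CompleteSpace E := FiniteDimensional.complete ℝ E
  have ha := hφ.mem_maximalAtlas
  have hz := φ.map_source hp
  -- The foliated condition is tested on a constant vertical field, for which `[X, K] = -DX·K`.
  set K := constField φ (verticalShift L c) with hK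
  have hKs : SmoothOn K φ.source := smoothOn_constField ha _
  have h1 := hX.bracket K (W ∩ φ.source) (hX.isOpen.inter φ.open_source) inter_subset_left
    (hKs.mono inter_subset_right) (fun x hx ↦ (hφ.mem_range_iff hx.2).2 (by
      rw [hK, constField, chartDeriv_chartDerivSymm ha hx.2, verticalShift_verticalShift]))
    p ⟨hpW, hp⟩
  rw [hφ.mem_range_iff hp, chartDeriv_mlieBracket ha hp (hX.smooth.diffAt hX.isOpen hpW)
    (hKs.diffAt φ.open_source hp), coordField_constField ha _ hz] at h1
  have h2 : coordField φ K =ᶠ[𝓝 (φ p)] fun _ ↦ verticalShift L c := by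
    filter_upwards [φ.open_target.mem_nhds hz] with z hz using coordField_constField ha _ hz
  rw [h2.fderiv_eq] at h1
  simpa using h1

/-- In coordinates, the Hessian of a Lagrangian is its Hessian with respect to the variables
`yⁱ`. -/
theorem hessian_eq {f : M → ℝ} {U : Set M} (hU : IsOpen U)
    (hf : ContMDiffOn 𝓘(ℝ, E) 𝓘(ℝ, ℝ) ∞ f U) {p : M} (hp : p ∈ φ.source) (hpU : p ∈ U)
    (u v : TangentSpace 𝓘(ℝ, E) p) :
    hessian T f p u v = fderiv ℝ (fderiv ℝ (f ∘ φ.symm)) (φ p)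
      (verticalShift L (chartDeriv φ p v)) (verticalShift L (chartDeriv φ p u)) := by
  have : CompleteSpace E := FiniteDimensional.complete ℝ E
  have ha := hφ.mem_maximalAtlas
  have hz := φ.map_source hp
  obtain ⟨⟨W, hpW, hX⟩, hXu⟩ := (exists_foliated_extension T p u).choose_spec
  obtain ⟨-, hYv⟩ := (exists_foliated_extension T p v).choose_spec
  change IsFoliatedOn T (foliatedExtension T p u) W at hX
  change foliatedExtension T p u p = u at hXu
  change foliatedExtension T p v p = v at hYv
  set X := foliatedExtension T p u
  set Y := foliatedExtension T p v
  have hF : ContDiffAt ℝ ∞ (f ∘ φ.symm) (φ p) := by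
    refine ContMDiffAt.contDiffAt ?_
    refine ContMDiffAt.comp_of_eq (hf.contMDiffAt (hU.mem_nhds hpU))
      ((contMDiffOn_symm_of_mem_maximalAtlas ha).contMDiffAt (φ.open_target.mem_nhds hz))
      (φ.left_inv hp)
  have hdF : DifferentiableAt ℝ (fderiv ℝ (f ∘ φ.symm)) (φ p) :=
    (hF.fderiv_right (m := ∞) (by simp)).differentiableAt (by simp)
  have hX' := differentiableAt_coordField ha hp (hX.smooth.diffAt hX.isOpen hpW)
  set h : E → ℝ := fun z ↦ fderiv ℝ (f ∘ φ.symm) z (verticalShift L (coordField φ X z)) with hh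
  have hSX : HasFDerivAt (fun z ↦ verticalShift L (coordField φ X z))
      ((verticalShift L).comp (fderiv ℝ (coordField φ X) (φ p))) (φ p) :=
    (verticalShift L).hasFDerivAt.comp _ hX'.hasFDerivAt
  have hhd : DifferentiableAt ℝ h (φ p) := hdF.clm_apply hSX.differentiableAt
  have h1 : dirDeriv (T.app X) f =ᶠ[𝓝 p] h ∘ φ := by
    filter_upwards [φ.open_source.mem_nhds hp, hU.mem_nhds hpU] with q hq hqU
    rw [dirDeriv_eq_fderiv ha _ hq ((hf.contMDiffAt (hU.mem_nhds hqU)).mdifferentiableAt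
      (by simp)), hφ.coordField_app X (φ.map_source hq)]
    rfl
  have h2 : dirDeriv (T.app X) f ∘ φ.symm =ᶠ[𝓝 (φ p)] h := by
    have ht : Filter.Tendsto φ.symm (𝓝 (φ p)) (𝓝 p) := by
      have := φ.continuousAt_symm hz
      rwa [ContinuousAt, φ.left_inv hp] at this
    filter_upwards [φ.open_target.mem_nhds hz, ht.eventually h1] with z hz h
    simp only [Function.comp_apply] at h ⊢
    rw [h, φ.right_inv hz]
  have hmd : MDifferentiableAt 𝓘(ℝ, E) 𝓘(ℝ, ℝ) (dirDeriv (T.app X) f) p := by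
    refine MDifferentiableAt.congr_of_eventuallyEq ?_ h1
    exact hhd.mdifferentiableAt.comp p
      ((mdifferentiable_of_mem_maximalAtlas ha).mdifferentiableAt hp)
  -- The product rule gives `D²F(JY, JX) + DF(J (DX·JY))`. The second term vanishes because `X` is
  -- foliated.
  rw [hessian, dirDeriv_eq_fderiv ha _ hp hmd, h2.fderiv_eq, hφ.coordField_app Y hz, hh,
    fderiv_clm_apply hdF hSX.differentiableAt, hSX.fderiv, coordField_apply hp, coordField_apply hp,
    hXu, hYv]
  simp only [add_apply, ContinuousLinearMap.comp_apply, ContinuousLinearMap.flip_apply,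
    hφ.verticalShift_fderiv_of_isFoliatedOn hX hp hpW, map_zero, zero_add]

end Calculus

end IsAdaptedChart

end Adapted

/-- Transfers the symmetry of `DG` from the model space to the matrix of `G` on the `x`-components:
`A` is the linear change of coordinates and `j` the inclusion of the `x`-space. -/
theorem fderiv_bilinearComp_comp_apply {E P Q : Type*} [NormedAddCommGroup E] [NormedSpace ℝ E]
    [NormedAddCommGroup P] [NormedSpace ℝ P] [NormedAddCommGroup Q] [NormedSpace ℝ Q]
    {G : E → E →L[ℝ] E →L[ℝ] ℝ} {A : P →L[ℝ] E} {j : Q →L[ℝ] E} {w : P}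
    (hG : DifferentiableAt ℝ G (A w))
    (hG' : DifferentiableAt ℝ (fun w ↦ (G (A w)).bilinearComp j j) w) (a : P) (l m : Q) :
    fderiv ℝ (fun w ↦ (G (A w)).bilinearComp j j) w a l m
      = fderiv ℝ G (A w) (A a) (j l) (j m) := by
  have h1 : DifferentiableAt ℝ (fun z ↦ G z (j l) (j m)) (A w) :=
    (hG.clm_apply (by fun_prop)).clm_apply (by fun_prop)
  have h2 : fderiv ℝ (fun w ↦ (G (A w)).bilinearComp j j l m) w a
      = fderiv ℝ (fun w ↦ (G (A w)).bilinearComp j j) w a l m := by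
    rw [fderiv_clm_apply (hG'.clm_apply (by fun_prop)) (by fun_prop),
      fderiv_clm_apply hG' (by fun_prop)]
    simp
  have h3 : fderiv ℝ (fun w ↦ G (A w) (j l) (j m)) w a
      = fderiv ℝ G (A w) (A a) (j l) (j m) := by
    have h4 := (h1.hasFDerivAt.comp w A.hasFDerivAt).fderiv
    have h5 : fderiv ℝ (fun z ↦ G z (j l) (j m)) (A w) (A a)
        = fderiv ℝ G (A w) (A a) (j l) (j m) := by
      rw [fderiv_clm_apply (hG.clm_apply (by fun_prop)) (by fun_prop),
        fderiv_clm_apply hG (by fun_prop)]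
      simp
    rw [← h5]
    exact congrArg (fun B : P →L[ℝ] ℝ ↦ B a) h4
  exact h2.symm.trans h3

/-! ### The Cartan tensor, and its symmetry as the Lagrange condition. -/

section Tensors

variable {E : Type*} [NormedAddCommGroup E] [NormedSpace ℝ E]
  {M : Type*} [TopologicalSpace M] [ChartedSpace E M] [IsManifold 𝓘(ℝ, E) ∞ M]

theorem TangentStructure.app_mem_range (T : TangentStructure E M) (X : VField E M) (p : M) :
    T.app X p ∈ (T.S p).range := ⟨X p, rfl⟩

theorem TangentStructure.diffAt_app (T : TangentStructure E M) {X : VField E M} {p : M}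
    (hX : DiffAt X p) : DiffAt (T.app X) p := hX.app T.smooth

theorem diffAt_extend {p : M} (u : TangentSpace 𝓘(ℝ, E) p) :
    DiffAt (FiberBundle.extend E u : VField E M) p :=
  (FiberBundle.contMDiffAt_extend 𝓘(ℝ, E) E (k := 1) u).mdifferentiableAt one_ne_zero

variable [FiniteDimensional ℝ E]

/-- A local extension is cut off by a bump function, which is globally smooth because `M` is
Hausdorff. -/
theorem exists_smooth_extension [T2Space M] {p : M} (u : TangentSpace 𝓘(ℝ, E) p) :
    ∃ X : VField E M, SmoothOn X univ ∧ X p = u := by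
  obtain ⟨s, hs, hsu⟩ := FiberBundle.exists_contMDiffOn_extend (k := ∞) 𝓘(ℝ, E) E u
  obtain ⟨f, hf, -⟩ := (SmoothBumpFunction.nhds_basis_support (I := 𝓘(ℝ, E))
    (interior_mem_nhds.2 hs)).mem_iff.1 Filter.univ_mem
  refine ⟨fun x ↦ f x • FiberBundle.extend E u x, ?_, ?_⟩
  · exact (ContMDiffOn.smul_section_of_tsupport f.contMDiff.contMDiffOn isOpen_interior hf
      (hsu.mono interior_subset)).contMDiffOn
  · simp

/-- The right-hand side involves only the vectors at `p`, so no choice of extension matters. -/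
theorem IsAdaptedChart.cartanTensor_eq {T : TangentStructure E M}
    {φ : OpenPartialHomeomorph M E} {n : ℕ} {L : E ≃L[ℝ] (Fin n → ℝ) × (Fin n → ℝ)}
    (hφ : IsAdaptedChart T φ L) (g : TransversalMetric T) {p : M} (hp : p ∈ φ.source)
    (u v w : TangentSpace 𝓘(ℝ, E) p) :
    cartanTensor g p u v w = fderiv ℝ (coordForm φ g.form) (φ p)
      (verticalShift L (chartDeriv φ p u)) (chartDeriv φ p v) (chartDeriv φ p w) := by
  obtain ⟨⟨W, hpW, hX⟩, hXu⟩ := (exists_foliated_extension T p u).choose_spec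
  change IsFoliatedOn T (foliatedExtension T p u) W at hX
  change foliatedExtension T p u p = u at hXu
  rw [cartanTensor, hφ.lieDerivForm_eq g.smooth g.symm g.vertical hp
    (T.diffAt_app (hX.smooth.diffAt hX.isOpen hpW))
    (.of_forall fun q ↦ T.app_mem_range _ q) (diffAt_extend v) (diffAt_extend w)]
  simp only [TangentStructure.app, FiberBundle.extend_apply_self]
  rw [hφ.chartDeriv_S p hp, hXu]

/-- The Cartan tensor is the Lie derivative along `SX`, for an arbitrary (not necessarily
foliated) extension `X`. -/
theorem cartanTensor_eq_lieDerivForm {T : TangentStructure E M} (g : TransversalMetric T) {p : M}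
    {X Y Z : VField E M} (hX : DiffAt X p) (hY : DiffAt Y p) (hZ : DiffAt Z p) :
    cartanTensor g p (X p) (Y p) (Z p) = lieDerivForm (T.app X) g.form Y Z p := by
  obtain ⟨φ, n, L, hp, hφ⟩ := exists_isAdaptedChart T p
  rw [hφ.cartanTensor_eq g hp, hφ.lieDerivForm_eq g.smooth g.symm g.vertical hp
    (T.diffAt_app hX) (.of_forall fun q ↦ T.app_mem_range _ q) hY hZ, ← hφ.chartDeriv_S p hp]
  rfl

/-- The Cartan tensor of a locally Lagrange metric is symmetric. -/
theorem TransversalMetric.IsLocallyLagrange.cartanTensor_symm {T : TangentStructure E M}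
    {g : TransversalMetric T} (hg : g.IsLocallyLagrange) (p : M)
    (u v w : TangentSpace 𝓘(ℝ, E) p) : cartanTensor g p u v w = cartanTensor g p v u w := by
  obtain ⟨φ, n, L, hp, hφ⟩ := exists_isAdaptedChart T p
  obtain ⟨U, f, hU, hpU, hf, hgf⟩ := hg p
  have ha := hφ.mem_maximalAtlas
  have hz := φ.map_source hp
  set F := f ∘ φ.symm with hFdef
  have hF : ContDiffAt ℝ ∞ F (φ p) := by
    refine ContMDiffAt.contDiffAt ?_
    refine ContMDiffAt.comp_of_eq (hf.contMDiffAt (hU.mem_nhds hpU))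
      ((contMDiffOn_symm_of_mem_maximalAtlas ha).contMDiffAt (φ.open_target.mem_nhds hz))
      (φ.left_inv hp)
  have hF1 : ContDiffAt ℝ ∞ (fderiv ℝ F) (φ p) := hF.fderiv_right (by simp)
  have hF2 : DifferentiableAt ℝ (fderiv ℝ (fderiv ℝ F)) (φ p) :=
    (hF1.fderiv_right (m := ∞) (by simp)).differentiableAt (by simp)
  have hG : DifferentiableAt ℝ (coordForm φ g.form) (φ p) :=
    ((contDiffOn_coordForm ha g.smooth).contDiffAt (φ.open_target.mem_nhds hz)).differentiableAt
      (by simp)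
  have hGF : ∀ c d, (fun z ↦ coordForm φ g.form z c d) =ᶠ[𝓝 (φ p)] fun z ↦
      fderiv ℝ (fderiv ℝ F) z (verticalShift L c) (verticalShift L d) := fun c d ↦ by
    have ht : Filter.Tendsto φ.symm (𝓝 (φ p)) (𝓝 p) := by
      have := φ.continuousAt_symm hz
      rwa [ContinuousAt, φ.left_inv hp] at this
    filter_upwards [φ.open_target.mem_nhds hz, ht.eventually (hU.mem_nhds hpU)] with z hz hzU
    have hs := φ.map_target hz
    rw [coordForm_symm g.symm, coordForm_apply, hgf _ hzU, hφ.hessian_eq hU hf hs hzU]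
    simp only [constField, chartDeriv_chartDerivSymm ha hs, φ.right_inv hz]
    rfl
  -- Since `G(c, d) = D²F(Jc, Jd)`, the Cartan tensor becomes `D³F(Ju, Jv, Jw)`; symmetry of the
  -- second derivative of `DF` then finishes.
  have key : ∀ a c d, fderiv ℝ (coordForm φ g.form) (φ p) a c d
      = fderiv ℝ (fderiv ℝ (fderiv ℝ F)) (φ p) a (verticalShift L c) (verticalShift L d) := by
    intro a c d
    have h1 := congrArg (fun A : E →L[ℝ] ℝ ↦ A a) ((hGF c d).fderiv_eq (𝕜 := ℝ))
    rw [fderiv_clm_apply (hG.clm_apply (by fun_prop)) (by fun_prop),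
      fderiv_clm_apply hG (by fun_prop), fderiv_clm_apply (hF2.clm_apply (by fun_prop))
        (by fun_prop), fderiv_clm_apply hF2 (by fun_prop)] at h1
    simpa using h1
  have hs := hF1.isSymmSndFDerivAt (by simpa using (ENat.LEInfty.out : (2 : WithTop ℕ∞) ≤ ∞))
  rw [hφ.cartanTensor_eq g hp, hφ.cartanTensor_eq g hp, key, key, hs.eq]

/-- A transversal metric with symmetric Cartan tensor is locally Lagrange. -/
theorem isLocallyLagrange_of_cartanTensor_symm {T : TangentStructure E M}
    {g : TransversalMetric T}
    (hC : ∀ p u v w, cartanTensor g p u v w = cartanTensor g p v u w) :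
    g.IsLocallyLagrange := by
  intro p
  obtain ⟨φ, n, L, hp, hφ⟩ := exists_isAdaptedChart T p
  have ha := hφ.mem_maximalAtlas
  set G := coordForm φ g.form with hGdef
  have hG : ContDiffOn ℝ ∞ G φ.target := contDiffOn_coordForm ha g.smooth
  have hCG : ∀ z ∈ φ.target, ∀ a b c,
      fderiv ℝ G z (verticalShift L a) b c = fderiv ℝ G z (verticalShift L b) a c := by
    intro z hz a b c
    have hs := φ.map_target hz
    have := hC (φ.symm z) (chartDerivSymm φ _ a) (chartDerivSymm φ _ b) (chartDerivSymm φ _ c)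
    rw [hφ.cartanTensor_eq g hs, hφ.cartanTensor_eq g hs] at this
    simpa only [chartDeriv_chartDerivSymm ha hs, φ.right_inv hz] using this
  set j : (Fin n → ℝ) →L[ℝ] E := (L.symm : (Fin n → ℝ) × (Fin n → ℝ) →L[ℝ] E).comp
    (ContinuousLinearMap.inl ℝ (Fin n → ℝ) (Fin n → ℝ)) with hj
  have hjS : ∀ k, verticalShift L (j k) = L.symm (0, k) := fun k ↦ by
    simp [verticalShift_apply, hj]
  -- `G` annihilates vertical vectors, so it is recovered from its restriction to the `x`-space.
  have hjG : ∀ z ∈ φ.target, ∀ c d, G z (j (L c).1) (j (L d).1) = G z c d := by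
    intro z hz
    have h1 : ∀ c d, G z (j (L c).1) d = G z c d := by
      intro c d
      have h2 : c = j (L c).1 + verticalShift L (j (L c).2) := by
        rw [hjS]
        apply L.injective
        simp [hj]
      conv_rhs => rw [h2]
      rw [map_add, add_apply, hφ.coordForm_verticalShift_left g.vertical hz, add_zero]
    intro c d
    rw [h1, hGdef, coordForm_symm g.symm, ← hGdef, h1, hGdef, coordForm_symm g.symm]
  set G' : (Fin n → ℝ) × (Fin n → ℝ) → (Fin n → ℝ) →L[ℝ] (Fin n → ℝ) →L[ℝ] ℝ :=
    fun w ↦ (G (L.symm w)).bilinearComp j j with hG'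
  obtain ⟨ε, hε, hεt⟩ := Metric.isOpen_iff.1 (φ.open_target.preimage L.symm.continuous)
    (L (φ p)) (by simpa using φ.map_source hp)
  have hG's : ContDiffOn ℝ ∞ G' (Metric.ball (L (φ p)) ε) := by
    rw [contDiffOn_clm_apply]
    intro k
    rw [contDiffOn_clm_apply]
    intro l
    have h1 : ContDiffOn ℝ ∞ (fun w ↦ G (L.symm w)) (Metric.ball (L (φ p)) ε) :=
      hG.comp L.symm.contDiff.contDiffOn hεt
    exact (h1.clm_apply contDiffOn_const).clm_apply contDiffOn_const
  obtain ⟨F, hF, hFG⟩ := exists_partial_hessian hG's (fun w _ k l ↦ g.symm _ _ _) (by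
    intro w hw k l m
    have h1 : DifferentiableAt ℝ G (L.symm w) :=
      (hG.contDiffAt (φ.open_target.mem_nhds (hεt hw))).differentiableAt (by simp)
    have key : ∀ k l m, fderiv ℝ G' w (0, k) l m
        = fderiv ℝ G (L.symm w) (verticalShift L (j k)) (j l) (j m) := fun k l m ↦ by
      rw [hjS]
      exact fderiv_bilinearComp_comp_apply
        (A := (L.symm : (Fin n → ℝ) × (Fin n → ℝ) →L[ℝ] E)) h1
        ((hG's.contDiffAt (Metric.isOpen_ball.mem_nhds hw)).differentiableAt (by simp)) _ l m
    rw [key, key, hCG _ (hεt hw)])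
  have hV : IsOpen (L ⁻¹' Metric.ball (L (φ p)) ε) := Metric.isOpen_ball.preimage L.continuous
  set U := φ.source ∩ φ ⁻¹' (L ⁻¹' Metric.ball (L (φ p)) ε) with hUdef
  have hU : IsOpen U := φ.isOpen_inter_preimage hV
  have hf : ContMDiffOn 𝓘(ℝ, E) 𝓘(ℝ, ℝ) ∞ (fun x ↦ F (L (φ x))) U :=
    (hF.comp L.contDiff.contDiffOn (fun _ h ↦ h)).contMDiffOn.comp
      ((contMDiffOn_of_mem_maximalAtlas ha).mono inter_subset_left) fun x hx ↦ hx.2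
  refine ⟨U, fun x ↦ F (L (φ x)), hU, ⟨hp, by simpa using hε⟩, hf, fun x hx u v ↦ ?_⟩
  have hxt := φ.map_source hx.1
  rw [hφ.hessian_eq hU hf hx.1 hx]
  have hFx : ∀ z ∈ L ⁻¹' Metric.ball (L (φ p)) ε, ContDiffAt ℝ ∞ F (L z) := fun z hz ↦
    hF.contDiffAt (Metric.isOpen_ball.mem_nhds hz)
  have h1 : (fun x ↦ F (L (φ x))) ∘ φ.symm =ᶠ[𝓝 (φ x)] fun z ↦ F (L z) := by
    filter_upwards [φ.open_target.mem_nhds hxt] with z hz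
    simp [φ.right_inv hz]
  have h2 : fderiv ℝ (fun z ↦ F (L z)) =ᶠ[𝓝 (φ x)] fun z ↦
      (fderiv ℝ F (L z)).comp (L : E →L[ℝ] _) := by
    filter_upwards [hV.mem_nhds hx.2] with z hz
    exact (((hFx z hz).differentiableAt (by simp)).hasFDerivAt.comp z L.hasFDerivAt).fderiv
  have h3 : HasFDerivAt (fun z ↦ fderiv ℝ F (L z))
      ((fderiv ℝ (fderiv ℝ F) (L (φ x))).comp (L : E →L[ℝ] _)) (φ x) :=
    ((((hFx _ hx.2).fderiv_right (m := ∞) (by simp)).differentiableAt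
      (by simp)).hasFDerivAt).comp (φ x) L.hasFDerivAt
  have h4 := h3.clm_comp (hasFDerivAt_const (L : E →L[ℝ] _) (φ x))
  rw [(h1.fderiv.trans h2).fderiv_eq, h4.fderiv]
  have h5 : ∀ c, L (verticalShift L c) = (0, (L c).1) := fun c ↦ by simp [verticalShift_apply]
  simp only [add_apply, ContinuousLinearMap.comp_apply, zero_apply, map_zero, zero_add,
    ContinuousLinearMap.flip_apply, ContinuousLinearMap.compL_apply,
    ContinuousLinearEquiv.coe_coe, h5]
  rw [hFG _ hx.2, g.symm, ← coordForm_chartDeriv ha g.form hx.1, ← hGdef, ← hjG _ hxt]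
  simp [hG']

end Tensors

/-! ### Normalizations, the canonical connection and the canonical extension. -/

section Normalization

variable {E : Type*} [NormedAddCommGroup E] [NormedSpace ℝ E]
  {M : Type*} [TopologicalSpace M] [ChartedSpace E M] [IsManifold 𝓘(ℝ, E) ∞ M]
  {T : TangentStructure E M}

namespace Normalization

variable (N : Normalization T) {x : M}

theorem pN_apply_of_mem {u : TangentSpace 𝓘(ℝ, E) x} (hu : u ∈ N.horizontal x) :
    N.pN x u = u := by
  obtain ⟨v, rfl⟩ := hu
  exact N.idem x v

theorem pN_mem (u : TangentSpace 𝓘(ℝ, E) x) : N.pN x u ∈ N.horizontal x := ⟨u, rfl⟩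

theorem pN_eq_zero_iff {u : TangentSpace 𝓘(ℝ, E) x} : N.pN x u = 0 ↔ u ∈ (T.S x).range := by
  rw [← N.ker_eq, LinearMap.mem_ker]
  rfl

theorem sub_pN_mem (u : TangentSpace 𝓘(ℝ, E) x) : u - N.pN x u ∈ (T.S x).range := by
  rw [← N.pN_eq_zero_iff, map_sub, N.idem, sub_self]

variable {N}

theorem IsHorizontalField.diffAt {X : VField E M} (hX : N.IsHorizontalField X) (p : M) :
    DiffAt X p := hX.1.diffAt isOpen_univ (mem_univ p)

theorem IsHorizontalField.hor_eq {X : VField E M} (hX : N.IsHorizontalField X) : N.hor X = X :=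
  funext fun x ↦ N.pN_apply_of_mem (hX.2 x)

theorem IsHorizontalField.ver_eq {X : VField E M} (hX : N.IsHorizontalField X) : N.ver X = 0 :=
  funext fun x ↦ sub_eq_zero.2 (N.pN_apply_of_mem (hX.2 x)).symm

variable (N)

theorem exists_isHorizontalField [FiniteDimensional ℝ E] [T2Space M] {u : TangentSpace 𝓘(ℝ, E) x}
    (hu : u ∈ N.horizontal x) : ∃ X, N.IsHorizontalField X ∧ X x = u := by
  obtain ⟨X, hX, hXu⟩ := exists_smooth_extension u
  refine ⟨N.hor X, ⟨hX.app N.smooth, fun y ↦ N.pN_mem _⟩, ?_⟩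
  rw [hor, hXu, N.pN_apply_of_mem hu]

theorem hor_app (X : VField E M) : N.hor (T.app X) = 0 :=
  funext fun x ↦ N.pN_eq_zero_iff.2 (T.app_mem_range X x)

theorem ver_app (X : VField E M) : N.ver (T.app X) = T.app X := by
  funext x
  have := congrFun (N.hor_app X) x
  rw [ver, show N.pN x (T.app X x) = 0 from this, sub_zero]

/-- `D_{SX} Y = p_N [SX, Y]` for horizontal `Y`. -/
theorem canonicalConnection_app
    (nabla : CovariantDerivative 𝓘(ℝ, E) E (fun x : M ↦ TangentSpace 𝓘(ℝ, E) x))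
    (X : VField E M) {Y : VField E M} (hY : N.IsHorizontalField Y) (p : M) :
    canonicalConnection N nabla (T.app X) Y p
      = N.pN p (mlieBracket 𝓘(ℝ, E) (T.app X) Y p) := by
  have h1 : N.hor (fun x ↦ nabla Y x (N.hor (T.app X) x)) p = 0 := by
    rw [N.hor_app]
    simp [hor]
  have h2 : N.ver (fun x ↦ nabla (N.ver Y) x (T.app X x)) p = 0 := by
    rw [hY.ver_eq, CovariantDerivative.zero]
    simp [ver]
  have h3 : N.ver (mlieBracket 𝓘(ℝ, E) (N.hor (T.app X)) (N.ver Y)) p = 0 := by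
    rw [hY.ver_eq, mlieBracket_zero_right]
    simp [ver]
  simp only [canonicalConnection, Pi.add_apply, hY.hor_eq, h1, h2, h3, N.ver_app, zero_add,
    add_zero]
  rfl

end Normalization

theorem TransversalMetric.form_left_eq_zero (g : TransversalMetric T) {x : M}
    {u : TangentSpace 𝓘(ℝ, E) x} (hu : u ∈ (T.S x).range) (v : TangentSpace 𝓘(ℝ, E) x) :
    g.form x u v = 0 := by
  obtain ⟨w, rfl⟩ := hu
  exact g.vertical x w v

theorem TransversalMetric.form_pN_left (g : TransversalMetric T) (N : Normalization T) {x : M}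
    (u v : TangentSpace 𝓘(ℝ, E) x) : g.form x (N.pN x u) v = g.form x u v := by
  have h := g.form_left_eq_zero (N.sub_pN_mem u) v
  rw [map_sub, sub_apply, sub_eq_zero] at h
  exact h.symm

theorem TransversalMetric.form_pN_right (g : TransversalMetric T) (N : Normalization T) {x : M}
    (u v : TangentSpace 𝓘(ℝ, E) x) : g.form x u (N.pN x v) = g.form x u v := by
  rw [g.symm, g.form_pN_left, g.symm]

/-- The Cartan tensor depends only on the horizontal parts of its arguments. -/
theorem cartanTensor_pN [FiniteDimensional ℝ E] (g : TransversalMetric T) (N : Normalization T)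
    {p : M}
    (u v w : TangentSpace 𝓘(ℝ, E) p) :
    cartanTensor g p (N.pN p u) (N.pN p v) (N.pN p w) = cartanTensor g p u v w := by
  obtain ⟨φ, n, L, hp, hφ⟩ := exists_isAdaptedChart T p
  have ha := hφ.mem_maximalAtlas
  have hz := φ.map_source hp
  have hG : DifferentiableAt ℝ (coordForm φ g.form) (φ p) :=
    ((contDiffOn_coordForm ha g.smooth).contDiffAt (φ.open_target.mem_nhds hz)).differentiableAt
      (by simp)
  have key : ∀ a c d, fderiv ℝ (fun z ↦ coordForm φ g.form z c d) (φ p) a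
      = fderiv ℝ (coordForm φ g.form) (φ p) a c d := fun a c d ↦ by
    rw [fderiv_clm_apply (hG.clm_apply (by fun_prop)) (by fun_prop),
      fderiv_clm_apply hG (by fun_prop)]
    simp
  have hpN : ∀ u, ∃ d, chartDeriv φ p u = chartDeriv φ p (N.pN p u) + verticalShift L d := by
    intro u
    obtain ⟨d, hd⟩ := exists_eq_verticalShift L ((hφ.mem_range_iff hp).1 (N.sub_pN_mem u))
    exact ⟨d, by rw [← hd, map_sub, add_sub_cancel]⟩
  -- Constant vertical components drop out of `G` throughout the chart, hence out of its derivative.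
  -- In the first argument of the Cartan tensor they die because `J² = 0`.
  have hl : ∀ c c' d, (fun z ↦ coordForm φ g.form z (c + verticalShift L c') d)
      =ᶠ[𝓝 (φ p)] fun z ↦ coordForm φ g.form z c d := fun c c' d ↦ by
    filter_upwards [φ.open_target.mem_nhds hz] with z hz
    rw [map_add, add_apply, hφ.coordForm_verticalShift_left g.vertical hz, add_zero]
  have hr : ∀ c d d', (fun z ↦ coordForm φ g.form z c (d + verticalShift L d'))
      =ᶠ[𝓝 (φ p)] fun z ↦ coordForm φ g.form z c d := fun c d d' ↦ by
    simp only [coordForm_symm g.symm φ _ c]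
    exact hl d d' c
  obtain ⟨a, ha'⟩ := hpN u
  obtain ⟨b, hb⟩ := hpN v
  obtain ⟨c, hc⟩ := hpN w
  rw [hφ.cartanTensor_eq g hp, hφ.cartanTensor_eq g hp, ha', hb, hc, ← key, ← key,
    (hl _ _ _).fderiv_eq, (hr _ _ _).fderiv_eq, map_add, verticalShift_verticalShift, add_zero]

/-- `D_{SX}` and the bracket with `SX` differ on horizontal fields by vertical terms, which `g`
annihilates. -/
theorem cartanTensor_eq_covDerivForm [FiniteDimensional ℝ E] {N : Normalization T}
    {g : TransversalMetric T}
    {nabla : CovariantDerivative 𝓘(ℝ, E) E (fun x : M ↦ TangentSpace 𝓘(ℝ, E) x)}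
    {X Y Z : VField E M} (hX : N.IsHorizontalField X) (hY : N.IsHorizontalField Y)
    (hZ : N.IsHorizontalField Z) (p : M) :
    cartanTensor g p (X p) (Y p) (Z p)
      = covDerivForm (canonicalConnection N nabla) g.form (T.app X) Y Z p := by
  rw [cartanTensor_eq_lieDerivForm g (hX.diffAt p) (hY.diffAt p) (hZ.diffAt p), lieDerivForm,
    covDerivForm, N.canonicalConnection_app nabla X hY, N.canonicalConnection_app nabla X hZ,
    g.form_pN_left, g.form_pN_right]

section CanonicalExtension

variable {N : Normalization T} {g : TransversalMetric T} {γ : PseudoRiemannianMetric E M}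
  (hγ : IsCanonicalExtension N g γ)
  {nabla : CovariantDerivative 𝓘(ℝ, E) E (fun x : M ↦ TangentSpace 𝓘(ℝ, E) x)}

namespace IsCanonicalExtension

section

variable {X Y Z : VField E M} (hX : N.IsHorizontalField X) (hY : N.IsHorizontalField Y)
    (hZ : N.IsHorizontalField Z)

include hγ hY hZ

/-- `Y`, `Z`, `D_{SX} Y` and `D_{SX} Z` are all horizontal, where `g` and `γ` coincide. -/
theorem covDerivForm_eq (p : M) :
    covDerivForm (canonicalConnection N nabla) g.form (T.app X) Y Z p
      = covDerivForm (canonicalConnection N nabla) γ.form (T.app X) Y Z p := by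
  have h : (fun x ↦ g.form x (Y x) (Z x)) = fun x ↦ γ.form x (Y x) (Z x) :=
    funext fun x ↦ (hγ.restrict x _ (hY.2 x) _ (hZ.2 x)).symm
  rw [covDerivForm, covDerivForm, N.canonicalConnection_app nabla X hY,
    N.canonicalConnection_app nabla X hZ, h, hγ.restrict p _ (N.pN_mem _) _ (hZ.2 p),
    hγ.restrict p _ (hY.2 p) _ (N.pN_mem _)]

omit hY hZ in
theorem form_pN_left {p : M} (u : TangentSpace 𝓘(ℝ, E) p) {v : TangentSpace 𝓘(ℝ, E) p}
    (hv : v ∈ N.horizontal p) : γ.form p (N.pN p u) v = γ.form p u v := by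
  have h := hγ.orthogonal p v hv _ (N.sub_pN_mem u)
  rw [γ.symm, map_sub, sub_apply, sub_eq_zero] at h
  exact h.symm

-- Metricity expands `SX (γ(Y, Z))`, orthogonality removes `p_N` from the brackets, and vanishing
-- torsion turns `∇_{SX} Y - [SX, Y]` into `∇_Y (SX)`.
include hX in
theorem covDerivForm_eq_nabla (hnabla : IsLeviCivita γ nabla) (p : M) :
    covDerivForm (canonicalConnection N nabla) γ.form (T.app X) Y Z p
      = γ.form p (nabla (T.app X) p (Y p)) (Z p) + γ.form p (Y p) (nabla (T.app X) p (Z p)) := by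
  have hSX : DiffAt (T.app X) p := T.diffAt_app (hX.diffAt p)
  rw [covDerivForm, N.canonicalConnection_app nabla X hY, N.canonicalConnection_app nabla X hZ,
    dirDeriv, hnabla.metric p Y Z (hY.diffAt p) (hZ.diffAt p), hγ.form_pN_left _ (hZ.2 p),
    γ.symm p (Y p) (N.pN p _), hγ.form_pN_left _ (hY.2 p),
    ← hnabla.torsion_free p _ _ hSX (hY.diffAt p), ← hnabla.torsion_free p _ _ hSX (hZ.diffAt p),
    γ.symm p (Y p), γ.symm p (Y p)]
  simp only [map_sub, sub_apply]
  ring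

end

include hγ

/-- The normalization and the transversal metric are determined by the canonical extension. -/
theorem form_unique {N' : Normalization T} {g' : TransversalMetric T}
    (hγ' : IsCanonicalExtension N' g' γ) : g'.form = g.form := by
  -- The vertical part `u - p_N u` is orthogonal to `N`, and also to `im S`, since `u ∈ N'` and `p_N
  -- u ∈ N` both are. Nondegeneracy makes it zero.
  have hmem : ∀ x, ∀ u ∈ N'.horizontal x, u ∈ N.horizontal x := by
    intro x u hu
    have h : u - N.pN x u = 0 := by
      refine γ.nondegenerate x _ fun w ↦ ?_
      have h1 : γ.form x (u - N.pN x u) (N.pN x w) = 0 := by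
        rw [γ.symm]
        exact hγ.orthogonal x _ (N.pN_mem w) _ (N.sub_pN_mem u)
      have h2 : γ.form x (u - N.pN x u) (w - N.pN x w) = 0 := by
        rw [map_sub (γ.form x) u, sub_apply, hγ'.orthogonal x u hu _ (N.sub_pN_mem w),
          hγ.orthogonal x _ (N.pN_mem u) _ (N.sub_pN_mem w), sub_zero]
      rw [map_sub, h1, sub_zero] at h2
      exact h2
    rw [sub_eq_zero.1 h]
    exact N.pN_mem u
  have key : ∀ x u v, g'.form x u v = g.form x u v := by
    intro x u v
    rw [← g'.form_pN_left N', ← g'.form_pN_right N',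
      ← hγ'.restrict x _ (N'.pN_mem u) _ (N'.pN_mem v),
      hγ.restrict x _ (hmem x _ (N'.pN_mem u)) _ (hmem x _ (N'.pN_mem v)),
      g.form_pN_left, g.form_pN_right]
  funext x
  ext u v
  exact key x u v

theorem isLocallyLagrangeRiemann_iff [FiniteDimensional ℝ E] :
    IsLocallyLagrangeRiemann T γ ↔ g.IsLocallyLagrange := by
  refine ⟨?_, fun hg ↦ ⟨N, g, hg, hγ⟩⟩
  rintro ⟨N', g', hg', hγ'⟩
  rw [TransversalMetric.IsLocallyLagrange, hγ.form_unique hγ'] at hg'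
  exact hg'

end IsCanonicalExtension

end CanonicalExtension

/-- The Cartan tensor is pointwise and ignores vertical parts, and every horizontal vector extends
to a global horizontal field. Testing on such fields therefore detects full symmetry. -/
theorem isLocallyLagrange_iff_cartanTensor [FiniteDimensional ℝ E] [T2Space M]
    (g : TransversalMetric T) (N : Normalization T) :
    g.IsLocallyLagrange ↔ ∀ X Y Z : VField E M, N.IsHorizontalField X → N.IsHorizontalField Y →
      N.IsHorizontalField Z → ∀ p : M,
        cartanTensor g p (X p) (Y p) (Z p) = cartanTensor g p (Y p) (X p) (Z p) := by
  refine ⟨fun hg X Y Z _ _ _ p ↦ hg.cartanTensor_symm p _ _ _,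
    fun h ↦ isLocallyLagrange_of_cartanTensor_symm fun p u v w ↦ ?_⟩
  obtain ⟨X, hX, hXu⟩ := N.exists_isHorizontalField (N.pN_mem u)
  obtain ⟨Y, hY, hYv⟩ := N.exists_isHorizontalField (N.pN_mem v)
  obtain ⟨Z, hZ, hZw⟩ := N.exists_isHorizontalField (N.pN_mem w)
  rw [← cartanTensor_pN g N, ← cartanTensor_pN g N v, ← hXu, ← hYv, ← hZw]
  exact h X Y Z hX hY hZ p

end Normalization

end LagrangeGeometry

end

/-! ### The main theorem, assembled from the identities for the Cartan tensor. -/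

theorem proposition3p2
    {E : Type*} [NormedAddCommGroup E] [NormedSpace ℝ E] [FiniteDimensional ℝ E]
    {M : Type*} [TopologicalSpace M] [T2Space M] [ChartedSpace E M] [IsManifold 𝓘(ℝ, E) ∞ M]
    (T : LagrangeGeometry.TangentStructure E M)
    (N : LagrangeGeometry.Normalization T)
    (g : LagrangeGeometry.TransversalMetric T)
    (γ : LagrangeGeometry.PseudoRiemannianMetric E M)
    (hγ : LagrangeGeometry.IsCanonicalExtension N g γ)
    (nabla : CovariantDerivative 𝓘(ℝ, E) E (fun x : M ↦ TangentSpace 𝓘(ℝ, E) x))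
    (hnabla : LagrangeGeometry.IsLeviCivita γ nabla)
    (D : LagrangeGeometry.VField E M → LagrangeGeometry.VField E M → LagrangeGeometry.VField E M)
    (hD : D = LagrangeGeometry.canonicalConnection N nabla) :
    -- the Cartan tensor does not depend on the foliated extension used to define it
    (∀ (p : M) (W : Set M) (X Y Z : LagrangeGeometry.VField E M), p ∈ W →
      LagrangeGeometry.IsFoliatedOn T X W →
      LagrangeGeometry.SmoothOn Y W → LagrangeGeometry.SmoothOn Z W →
      LagrangeGeometry.cartanTensor g p (X p) (Y p) (Z p)
        = LagrangeGeometry.lieDerivForm (T.app X) g.form Y Z p) ∧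
    -- the three expressions of the Cartan tensor
    (∀ X Y Z : LagrangeGeometry.VField E M,
      N.IsHorizontalField X → N.IsHorizontalField Y → N.IsHorizontalField Z → ∀ p : M,
      LagrangeGeometry.cartanTensor g p (X p) (Y p) (Z p)
          = LagrangeGeometry.covDerivForm D g.form (T.app X) Y Z p ∧
      LagrangeGeometry.covDerivForm D g.form (T.app X) Y Z p
          = LagrangeGeometry.covDerivForm D γ.form (T.app X) Y Z p ∧
      LagrangeGeometry.covDerivForm D γ.form (T.app X) Y Z p
          = γ.form p (nabla (T.app X) p (Y p)) (Z p)
            + γ.form p (Y p) (nabla (T.app X) p (Z p))) ∧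
    -- the characterizations of locally Lagrange-Riemann metrics
    (LagrangeGeometry.IsLocallyLagrangeRiemann T γ ↔
      ∀ X Y Z : LagrangeGeometry.VField E M,
        N.IsHorizontalField X → N.IsHorizontalField Y → N.IsHorizontalField Z → ∀ p : M,
        LagrangeGeometry.covDerivForm D γ.form (T.app X) Y Z p
          = LagrangeGeometry.covDerivForm D γ.form (T.app Y) X Z p) ∧
    (LagrangeGeometry.IsLocallyLagrangeRiemann T γ ↔
      ∀ X Y Z : LagrangeGeometry.VField E M,
        N.IsHorizontalField X → N.IsHorizontalField Y → N.IsHorizontalField Z → ∀ p : M,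
        γ.form p (nabla (T.app X) p (Y p)) (Z p) + γ.form p (Y p) (nabla (T.app X) p (Z p))
          = γ.form p (nabla (T.app Y) p (X p)) (Z p)
            + γ.form p (X p) (nabla (T.app Y) p (Z p))) := by
  subst hD
  have hC : ∀ X Y Z : LagrangeGeometry.VField E M,
      N.IsHorizontalField X → N.IsHorizontalField Y → N.IsHorizontalField Z → ∀ p : M,
      LagrangeGeometry.cartanTensor g p (X p) (Y p) (Z p) = LagrangeGeometry.covDerivForm
        (LagrangeGeometry.canonicalConnection N nabla) γ.form (T.app X) Y Z p :=
    fun X Y Z hX hY hZ p ↦ (LagrangeGeometry.cartanTensor_eq_covDerivForm hX hY hZ p).trans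
      (hγ.covDerivForm_eq hY hZ p)
  have hiff : LagrangeGeometry.IsLocallyLagrangeRiemann T γ ↔
      ∀ X Y Z : LagrangeGeometry.VField E M,
        N.IsHorizontalField X → N.IsHorizontalField Y → N.IsHorizontalField Z → ∀ p : M,
        LagrangeGeometry.covDerivForm (LagrangeGeometry.canonicalConnection N nabla) γ.form
            (T.app X) Y Z p
          = LagrangeGeometry.covDerivForm (LagrangeGeometry.canonicalConnection N nabla) γ.form
            (T.app Y) X Z p := by
    rw [hγ.isLocallyLagrangeRiemann_iff, LagrangeGeometry.isLocallyLagrange_iff_cartanTensor g N]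
    constructor
    · intro h X Y Z hX hY hZ p
      rw [← hC X Y Z hX hY hZ, ← hC Y X Z hY hX hZ, h X Y Z hX hY hZ]
    · intro h X Y Z hX hY hZ p
      rw [hC X Y Z hX hY hZ, hC Y X Z hY hX hZ, h X Y Z hX hY hZ]
  refine ⟨?_, ?_, hiff, hiff.trans ?_⟩
  · intro p W X Y Z hp hX hY hZ
    exact LagrangeGeometry.cartanTensor_eq_lieDerivForm g (hX.smooth.diffAt hX.isOpen hp)
      (hY.diffAt hX.isOpen hp) (hZ.diffAt hX.isOpen hp)
  · intro X Y Z hX hY hZ p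
    exact ⟨LagrangeGeometry.cartanTensor_eq_covDerivForm hX hY hZ p, hγ.covDerivForm_eq hY hZ p,
      hγ.covDerivForm_eq_nabla hX hY hZ hnabla p⟩
  · constructor
    · intro h X Y Z hX hY hZ p
      rw [← hγ.covDerivForm_eq_nabla hX hY hZ hnabla, ← hγ.covDerivForm_eq_nabla hY hX hZ hnabla,
        h X Y Z hX hY hZ]
    · intro h X Y Z hX hY hZ p
      rw [hγ.covDerivForm_eq_nabla hX hY hZ hnabla, hγ.covDerivForm_eq_nabla hY hX hZ hnabla,
        h X Y Z hX hY hZ]
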